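/- All graphs are finite, nonempty and undirected. For a connected simple graph $G=(V,E)$ let $$\operatorname{Rel}(G;q)=\sum_{S\subseteq E,\ (V,S)\text{ connected}}(1-q)^{|S|}q^{|E|-|S|}$$ be its (all-terminal) reliability polynomial, and let $\mathcal Z_{\mathrm{simple}}=\{q\in\mathbb C:\operatorname{Rel}(G;q)=0\text{ for some connected simple graph }G\}$. For $m\ge 3$ and $n\ge 1$ let $C_m[K_{n+1}]$ be the simple graph obtained from the cycle $C_m$ by replacing each edge with a copy of the complete graph $K_{n+1}$, identifying two distinct vertices of the copy with the endpoints of the edge. Let $\overline{\mathbb D}$ be the closed unit disk in $\mathbb C$. Then: 1. Reliability roots of simple graphs are dense in the closed unit disk, i.e. $\overline{\mathbb D}\subseteq\overline{\mathcal Z_{\mathrm{simple}}}$. 2. The real reliability roots of simple graphs lying in $[-1,0]$ are dense in $[-1,0]$, and $\overline{\mathcal Z_{\mathrm{simple}}\cap\mathbb R}=[-1,0]\cup\{1\}$. 3. Both densities are already witnessed by the graphs $C_m[K_{n+1}]$ with $m\ge3$, $n\ge1$: these graphs are connected, the closure of the set of all their reliability roots contains $\overline{\mathbb D}$, and the set of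 their real reliability roots lying in $[-1,0]$ is dense in $[-1,0]$. -/

import Mathlib

open scoped Classical in
/-- The all-terminal reliability polynomial of a finite simple graph `G`, evaluated at a failure
probability `q`: the sum of `(1 - q) ^ |S| * q ^ (|E| - |S|)` over the edge sets `S ⊆ E` for which
the spanning subgraph `(V, S)` is connected. -/
noncomputable def reliability {V : Type*} [Fintype V] {R : Type*} [CommRing R]
    (G : SimpleGraph V) (q : R) : R :=
  ∑ S ∈ G.edgeFinset.powerset with
      (SimpleGraph.fromEdgeSet ((S : Finset (Sym2 V)) : Set (Sym2 V))).Connected,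
    (1 - q) ^ S.card * q ^ (G.edgeFinset.card - S.card)

/-- The set of complex reliability roots of (finite, nonempty) connected simple graphs. -/
def simpleReliabilityRoots : Set ℂ :=
  {q | ∃ (V : Type) (_ : Fintype V) (G : SimpleGraph V), G.Connected ∧ reliability G q = 0}

/-- The vertex set of the copy of `K_{n+1}` that replaces the edge `{i, i + 1}` of the cycle `C_m`.
The vertex `(i, 0)` is the `i`-th vertex of the cycle, and the vertices `(i, j)` with `0 < j < n`
are the `n - 1` non-terminal vertices of the `i`-th copy; the last vertex of this copy
is the next vertex of the cycle. -/
def cliqueBlock (m n : ℕ) (i : Fin m) : Set (Fin m × Fin n) :=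
  {x | x.1 = i ∨ ((x.1 : ℕ) = ((i : ℕ) + 1) % m ∧ (x.2 : ℕ) = 0)}

/-- The graph `C_m[K_{n+1}]` (for `m ≥ 3` and `n ≥ 1`): every edge of the cycle `C_m` is replaced
by a copy of the complete graph `K_{n+1}`, two distinct vertices of which are identified with
the endpoints of the edge. -/
def cycleOfCliques (m n : ℕ) : SimpleGraph (Fin m × Fin n) where
  Adj x y := x ≠ y ∧ ∃ i, x ∈ cliqueBlock m n i ∧ y ∈ cliqueBlock m n i
  symm := ⟨fun _ _ ⟨h, i, hx, hy⟩ => ⟨h.symm, i, hy, hx⟩⟩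
  loopless := ⟨fun _ h => h.1 rfl⟩

/-- The set of complex reliability roots of the graphs `C_m[K_{n+1}]` with `m ≥ 3`, `n ≥ 1`. -/
def cycleOfCliquesRoots : Set ℂ :=
  {q | ∃ m n : ℕ, 3 ≤ m ∧ 1 ≤ n ∧ reliability (cycleOfCliques m n) q = 0}

/-! Reliability is generalised to `connWeight w A`: a pair `e` inside `A` is absent with
"probability" `w e`, taken in any commutative ring. Conditioning on the component X of a root gives
Σ conn(X) · cut(X, A \ X) = 1. This recursion determines the weight (`eq_connWeight`), so structural
identities are proved by checking it. The main one: identifying two vertices adds to the connection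
weight the weight of having exactly two components that separate them (`connWeight_mergeWeight`).

Let R be the reliability of K_{n+1} and q^n S the weight of its splitting into two components that
separate two given vertices. A chain of m cliques has connection weight R^m and split weight m
R^(m-1) q^n S. Closing it up gives Rel(C_m[K_{n+1}]) = R^(m-1) (R + m q^n S), which is
`reliability_cycleOfCliques`. Uniformly on |q| ≤ ρ < 1, R → 1 and S → 2 as n → ∞
(`eventually_clique_bounds`), because only the splits that isolate one terminal survive. The second
factor thus resembles 1 + 2 m q^n, whose zeros are equally spaced on the circle of radius
(2m)^(-1/n); taking m ≈ |q₀|^(-n) puts one of them near q₀. The perturbation is controlled by a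
quantitative open mapping theorem in the coordinate t with m q^n = -e^t / 2 (`exists_zero_of_near`),
and on (-1, 0), with n odd, by the intermediate value theorem.

There are no further real roots except 1: the defining sum is positive on [0, 1), and for |x| > 1
deletion and contraction force a definite sign (`connWeight_sign`). The value 1 is a root of the
triangle. -/

/-! ### Connection weights: recursion, gluing, merging, deletion-contraction. -/

section ConnWeight

variable {V R : Type*} [CommRing R]

/-- The product of the weights of all pairs between `X` and `Y`. -/
def cutWeight (w : Sym2 V → R) (X Y : Finset V) : R :=
  ∏ x ∈ X, ∏ y ∈ Y, w s(x, y)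

lemma cutWeight_comm (w : Sym2 V → R) (X Y : Finset V) :
    cutWeight w X Y = cutWeight w Y X := by
  unfold cutWeight
  rw [Finset.prod_comm]
  simp only [Sym2.eq_swap]

lemma cutWeight_congr {w w' : Sym2 V → R} {X Y : Finset V}
    (h : ∀ x ∈ X, ∀ y ∈ Y, w s(x, y) = w' s(x, y)) : cutWeight w X Y = cutWeight w' X Y :=
  Finset.prod_congr rfl fun x hx => Finset.prod_congr rfl fun y hy => h x hx y hy

lemma cutWeight_eq_one {w : Sym2 V → R} {X Y : Finset V}
    (h : ∀ x ∈ X, ∀ y ∈ Y, w s(x, y) = 1) : cutWeight w X Y = 1 :=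
  Finset.prod_eq_one fun x hx => Finset.prod_eq_one fun y hy => h x hx y hy

lemma cutWeight_eq_zero {w : Sym2 V → R} {X Y : Finset V} {x y : V} (hx : x ∈ X) (hy : y ∈ Y)
    (h : w s(x, y) = 0) : cutWeight w X Y = 0 :=
  Finset.prod_eq_zero hx (Finset.prod_eq_zero hy h)

@[simp] lemma cutWeight_empty_right (w : Sym2 V → R) (X : Finset V) : cutWeight w X ∅ = 1 := by
  simp [cutWeight]

variable [DecidableEq V]

/-- The subsets of `A` that contain `r`. -/
def rootedSubsets (r : V) (A : Finset V) : Finset (Finset V) :=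
  A.powerset.filter (r ∈ ·)

@[simp] lemma mem_rootedSubsets {r : V} {A X : Finset V} :
    X ∈ rootedSubsets r A ↔ X ⊆ A ∧ r ∈ X := by
  simp [rootedSubsets]

lemma cutWeight_sdiff (w : Sym2 V → R) (X : Finset V) {Y Z : Finset V} (h : Y ⊆ Z) :
    cutWeight w X Z = cutWeight w X Y * cutWeight w X (Z \ Y) := by
  unfold cutWeight
  rw [← Finset.prod_mul_distrib]
  refine Finset.prod_congr rfl fun x _ => ?_
  rw [mul_comm, Finset.prod_sdiff h]

lemma cutWeight_union_right (w : Sym2 V → R) (X : Finset V) {Y Z : Finset V} (h : Disjoint Y Z) :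
    cutWeight w X (Y ∪ Z) = cutWeight w X Y * cutWeight w X Z := by
  unfold cutWeight
  rw [← Finset.prod_mul_distrib]
  exact Finset.prod_congr rfl fun x _ => Finset.prod_union h

lemma cutWeight_union_left (w : Sym2 V → R) (X : Finset V) {Y Z : Finset V} (h : Disjoint Y Z) :
    cutWeight w (Y ∪ Z) X = cutWeight w Y X * cutWeight w Z X := by
  rw [cutWeight_comm, cutWeight_union_right w X h, cutWeight_comm w X Y, cutWeight_comm w X Z]

/-- The connection weight of `A`, computed by conditioning on the component of the root `r`. -/
def rootedConnWeight (w : Sym2 V → R) (r : V) (A : Finset V) : R :=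
  1 - ∑ X : {X // X ∈ (rootedSubsets r A).erase A},
    rootedConnWeight w r X.1 * cutWeight w X.1 (A \ X.1)
termination_by A.card
decreasing_by
  have h := X.2
  simp only [Finset.mem_erase, mem_rootedSubsets] at h
  exact Finset.card_lt_card (Finset.ssubset_iff_subset_ne.2 ⟨h.2.1, h.1⟩)

lemma rootedConnWeight_sum (w : Sym2 V → R) {r : V} {A : Finset V} (hr : r ∈ A) :
    ∑ X ∈ rootedSubsets r A, rootedConnWeight w r X * cutWeight w X (A \ X) = 1 := by
  have hA : A ∈ rootedSubsets r A := by simp [hr]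
  rw [← Finset.add_sum_erase _ _ hA, rootedConnWeight,
    Finset.univ_eq_attach, Finset.sum_attach ((rootedSubsets r A).erase A)
      (fun X => rootedConnWeight w r X * cutWeight w X (A \ X))]
  simp

/-- The system is triangular with unit diagonal: the top term X = A has an empty cut, of weight 1,
and all other terms involve smaller sets. -/
lemma rootedConnWeight_unique {w : Sym2 V → R} {F G : Finset V → R} {r : V} {A : Finset V}
    (hr : r ∈ A)
    (hF : ∀ B ⊆ A, r ∈ B → ∑ X ∈ rootedSubsets r B, F X * cutWeight w X (B \ X) = 1)
    (hG : ∀ B ⊆ A, r ∈ B → ∑ X ∈ rootedSubsets r B, G X * cutWeight w X (B \ X) = 1) :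
    F A = G A := by
  induction A using Finset.strongInduction with
  | H A ih =>
    have hA : A ∈ rootedSubsets r A := by simp [hr]
    have h1 := hF A subset_rfl hr
    have h2 := hG A subset_rfl hr
    rw [← Finset.add_sum_erase _ _ hA] at h1 h2
    have : ∑ X ∈ (rootedSubsets r A).erase A, F X * cutWeight w X (A \ X) =
        ∑ X ∈ (rootedSubsets r A).erase A, G X * cutWeight w X (A \ X) := by
      refine Finset.sum_congr rfl fun X hX => ?_
      simp only [Finset.mem_erase, mem_rootedSubsets] at hX
      rw [ih X (Finset.ssubset_iff_subset_ne.2 ⟨hX.2.1, hX.1⟩) hX.2.2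
        (fun B hB => hF B (hB.trans hX.2.1)) (fun B hB => hG B (hB.trans hX.2.1))]
    rw [this] at h1
    simpa using h1.trans h2.symm

/-- The cut weights of an ordered pair of disjoint sets and of the rest, arranged symmetrically. -/
lemma cutWeight_mul_cutWeight (w : Sym2 V → R) {A X Y : Finset V} (hY : Y ⊆ A \ X) :
    cutWeight w X (A \ X) * cutWeight w Y ((A \ X) \ Y) =
      cutWeight w X Y * cutWeight w (X ∪ Y) (A \ (X ∪ Y)) := by
  have hd : Disjoint X Y := by
    rw [Finset.disjoint_left]
    intro x hx hy
    exact (Finset.mem_sdiff.1 (hY hy)).2 hx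
  rw [cutWeight_sdiff w X hY, cutWeight_union_left w _ hd, sdiff_sdiff]
  simp only [Finset.sup_eq_union]
  ring

/-- In the recursion rooted at r, the proper X containing s agree with those rooted at s by
induction. If X misses s, the component Y of s in the complement is revealed too; the resulting
double sum is symmetric under (r, X) ↔ (s, Y). -/
lemma rootedConnWeight_eq (w : Sym2 V → R) {r s : V} {A : Finset V} (hr : r ∈ A) (hs : s ∈ A) :
    rootedConnWeight w r A = rootedConnWeight w s A := by
  induction A using Finset.strongInduction with
  | H A ih =>
    have key : ∀ r s : V, r ∈ A → s ∈ A →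
        ∑ X ∈ (rootedSubsets r A).filter (s ∉ ·), rootedConnWeight w r X * cutWeight w X (A \ X) =
        ∑ X ∈ (rootedSubsets r A).filter (s ∉ ·), ∑ Y ∈ rootedSubsets s (A \ X),
          rootedConnWeight w r X * rootedConnWeight w s Y *
            (cutWeight w X Y * cutWeight w (X ∪ Y) (A \ (X ∪ Y))) := by
      intro r s hr hs
      refine Finset.sum_congr rfl fun X hX => ?_
      simp only [Finset.mem_filter, mem_rootedSubsets] at hX
      have := rootedConnWeight_sum w (r := s) (A := A \ X) (by simp [hs, hX.2])
      rw [← mul_one (_ * cutWeight w X (A \ X)), ← this, Finset.mul_sum]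
      refine Finset.sum_congr rfl fun Y hY => ?_
      simp only [mem_rootedSubsets] at hY
      rw [← cutWeight_mul_cutWeight w hY.1]
      ring
    have hswap : ∑ X ∈ (rootedSubsets r A).filter (s ∉ ·),
          rootedConnWeight w r X * cutWeight w X (A \ X) =
        ∑ X ∈ (rootedSubsets s A).filter (r ∉ ·),
          rootedConnWeight w s X * cutWeight w X (A \ X) := by
      rw [key r s hr hs, key s r hs hr]
      rw [Finset.sum_comm' (t' := (rootedSubsets s A).filter (r ∉ ·))
        (s' := fun Y => rootedSubsets r (A \ Y))]
      · refine Finset.sum_congr rfl fun X _ => Finset.sum_congr rfl fun Y _ => ?_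
        rw [cutWeight_comm w Y X, Finset.union_comm]
        ring
      · intro X Y
        simp only [Finset.mem_filter, mem_rootedSubsets, Finset.subset_sdiff, Finset.disjoint_left]
        grind
    have h1 := rootedConnWeight_sum w hr
    have h2 := rootedConnWeight_sum w hs
    rw [← Finset.sum_filter_add_sum_filter_not _ (s ∈ ·)] at h1
    rw [← Finset.sum_filter_add_sum_filter_not _ (r ∈ ·)] at h2
    have hset : (rootedSubsets s A).filter (r ∈ ·) = (rootedSubsets r A).filter (s ∈ ·) := by
      ext X
      simp only [Finset.mem_filter, mem_rootedSubsets]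
      tauto
    rw [hset] at h2
    have hA : A ∈ (rootedSubsets r A).filter (s ∈ ·) := by simp [hr, hs]
    rw [← Finset.add_sum_erase _ _ hA] at h1 h2
    have : ∑ X ∈ ((rootedSubsets r A).filter (s ∈ ·)).erase A,
          rootedConnWeight w r X * cutWeight w X (A \ X) =
        ∑ X ∈ ((rootedSubsets r A).filter (s ∈ ·)).erase A,
          rootedConnWeight w s X * cutWeight w X (A \ X) := by
      refine Finset.sum_congr rfl fun X hX => ?_
      simp only [Finset.mem_erase, Finset.mem_filter, mem_rootedSubsets] at hX
      rw [ih X (Finset.ssubset_iff_subset_ne.2 ⟨hX.2.1.1, hX.1⟩) hX.2.1.2 hX.2.2]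
    rw [this, hswap] at h1
    simpa using h1.trans h2.symm

/-- The connection weight of `A`: if each pair `e` is independently absent with probability `w e`,
this is the probability that the present pairs inside `A` connect `A`. -/
noncomputable def connWeight (w : Sym2 V → R) (A : Finset V) : R :=
  if h : A.Nonempty then rootedConnWeight w h.choose A else 0

lemma connWeight_eq_rooted (w : Sym2 V → R) {r : V} {A : Finset V} (hr : r ∈ A) :
    connWeight w A = rootedConnWeight w r A := by
  have h : A.Nonempty := ⟨r, hr⟩
  rw [connWeight, dif_pos h]
  exact rootedConnWeight_eq w h.choose_spec hr

lemma connWeight_sum (w : Sym2 V → R) {r : V} {A : Finset V} (hr : r ∈ A) :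
    ∑ X ∈ rootedSubsets r A, connWeight w X * cutWeight w X (A \ X) = 1 := by
  rw [← rootedConnWeight_sum w hr]
  refine Finset.sum_congr rfl fun X hX => ?_
  rw [connWeight_eq_rooted w (mem_rootedSubsets.1 hX).2]

/-- The standard tool below: a candidate formula is correct once it satisfies the recursion for one
fixed root on all subsets of `A` containing it. -/
lemma eq_connWeight {w : Sym2 V → R} {F : Finset V → R} {r : V} {A : Finset V}
    (hr : r ∈ A)
    (hF : ∀ B ⊆ A, r ∈ B → ∑ X ∈ rootedSubsets r B, F X * cutWeight w X (B \ X) = 1) :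
    F A = connWeight w A :=
  rootedConnWeight_unique hr hF fun _ _ => connWeight_sum w

lemma connWeight_singleton (w : Sym2 V → R) (r : V) : connWeight w {r} = 1 := by
  have h := connWeight_sum w (Finset.mem_singleton_self r)
  have : rootedSubsets r {r} = {{r}} := by
    ext X
    simp only [mem_rootedSubsets, Finset.subset_singleton_iff, Finset.mem_singleton]
    constructor
    · rintro ⟨rfl | h, h'⟩
      · simp at h'
      · exact h
    · rintro rfl
      simp
  rw [this] at h
  simpa using h

lemma connWeight_congr {w w' : Sym2 V → R} {A : Finset V}
    (h : ∀ x ∈ A, ∀ y ∈ A, x ≠ y → w s(x, y) = w' s(x, y)) :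
    connWeight w A = connWeight w' A := by
  rcases A.eq_empty_or_nonempty with rfl | ⟨r, hr⟩
  · simp [connWeight]
  refine eq_connWeight hr fun B hB hrB => ?_
  rw [← connWeight_sum w hrB]
  refine Finset.sum_congr rfl fun X hX => ?_
  rw [mem_rootedSubsets] at hX
  congr 1
  refine cutWeight_congr fun x hx y hy => ?_
  rw [Finset.mem_sdiff] at hy
  exact (h x (hB (hX.1 hx)) y (hB hy.1) (by rintro rfl; exact hy.2 hx)).symm

lemma connWeight_map {V' : Type*} [DecidableEq V'] (f : V ↪ V') (w : Sym2 V' → R) (A : Finset V) :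
    connWeight w (A.map f) = connWeight (fun e => w (e.map f)) A := by
  rcases A.eq_empty_or_nonempty with rfl | ⟨r, hr⟩
  · simp [connWeight]
  refine eq_connWeight (F := fun A => connWeight w (A.map f)) hr fun B hB hrB => ?_
  rw [← connWeight_sum w (r := f r) (A := B.map f) (by simpa using hrB)]
  refine Finset.sum_bij (fun X _ => X.map f) ?_ ?_ ?_ ?_
  · intro X hX
    simpa using hX
  · intro X _ Y _ h
    exact Finset.map_injective f h
  · intro Y hY
    rw [mem_rootedSubsets, Finset.subset_map_iff] at hY
    obtain ⟨⟨X, hX, rfl⟩, hr⟩ := hY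
    exact ⟨X, by simpa [hX] using hr, rfl⟩
  · intro X _
    congr 1
    rw [← Finset.map_sdiff]
    simp [cutWeight]

/-- A disconnected set has connection weight zero. -/
lemma connWeight_union_eq_zero {w : Sym2 V → R} {P Q : Finset V} (hP : P.Nonempty)
    (hQ : Q.Nonempty) (hd : Disjoint P Q) (h : ∀ x ∈ P, ∀ y ∈ Q, w s(x, y) = 1) :
    connWeight w (P ∪ Q) = 0 := by
  obtain ⟨r, hr⟩ := hP
  -- The candidate vanishes on sets leaving P, so its recursion on B reduces to the genuine one on B
  -- ∩ P.
  have := eq_connWeight (w := w) (F := fun X => if X ⊆ P then connWeight w X else 0) (r := r)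
    (A := P ∪ Q) (by simp [hr]) ?_
  · rw [← this, if_neg]
    intro hs
    obtain ⟨q, hq⟩ := hQ
    exact Finset.disjoint_left.1 hd (hs (Finset.mem_union_right _ hq)) hq
  · intro B hB hrB
    have hrP : r ∈ B ∩ P := by simp [hr, hrB]
    rw [← connWeight_sum w hrP]
    symm
    refine Finset.sum_subset_zero_on_sdiff ?_ ?_ ?_
    · intro X
      simp only [mem_rootedSubsets, Finset.subset_inter_iff]
      tauto
    · intro X hX
      simp only [Finset.mem_sdiff, mem_rootedSubsets, Finset.subset_inter_iff] at hX
      rw [if_neg (by tauto), zero_mul]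
    · intro X hX
      simp only [mem_rootedSubsets, Finset.subset_inter_iff] at hX
      rw [if_pos hX.1.2]
      congr 1
      have hsub : (B ∩ P) \ X ⊆ B \ X := Finset.sdiff_subset_sdiff Finset.inter_subset_left subset_rfl
      rw [cutWeight_sdiff w X hsub, cutWeight_eq_one (Y := (B \ X) \ _), mul_one]
      intro x hx y hy
      refine h x (hX.1.2 hx) y ?_
      have := @hB y
      simp only [Finset.mem_sdiff, Finset.mem_inter, Finset.mem_union] at hy this
      tauto

/-- The connection weight is multiplicative when gluing at one vertex. -/
lemma connWeight_union {w : Sym2 V → R} {B C : Finset V} {v : V} (hv : B ∩ C = {v})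
    (h : ∀ x ∈ B, ∀ y ∈ C, x ≠ v → y ≠ v → w s(x, y) = 1) :
    connWeight w (B ∪ C) = connWeight w B * connWeight w C := by
  have hmem : ∀ x, x ∈ B ∧ x ∈ C ↔ x = v := fun x => by
    rw [← Finset.mem_inter, hv, Finset.mem_singleton]
  have hvB := ((hmem v).2 rfl).1
  have hvC := ((hmem v).2 rfl).2
  have := eq_connWeight (w := w) (F := fun X => connWeight w (X ∩ B) * connWeight w (X ∩ C))
    (r := v) (A := B ∪ C) (by simp [hvB]) ?_
  · rw [← this, Finset.inter_eq_right.2 Finset.subset_union_left,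
      Finset.inter_eq_right.2 Finset.subset_union_right]
  · intro D hD hvD
    rw [← mul_one (1 : R)]
    nth_rw 1 [← connWeight_sum w (r := v) (A := D ∩ B) (by simp [hvB, hvD])]
    rw [← connWeight_sum w (r := v) (A := D ∩ C) (by simp [hvC, hvD]), Finset.sum_mul_sum,
      ← Finset.sum_product']
    -- A component through the cut vertex is a free choice of one component in each piece, and its
    -- cut weight factors since pairs across the pieces have weight 1.
    refine Finset.sum_bij' (fun X _ => (X ∩ B, X ∩ C)) (fun p _ => p.1 ∪ p.2) ?_ ?_ ?_ ?_ ?_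
    · intro X hX
      simp only [mem_rootedSubsets, Finset.mem_product, Finset.mem_inter] at hX ⊢
      exact ⟨⟨Finset.inter_subset_inter_right hX.1, hX.2, hvB⟩,
        Finset.inter_subset_inter_right hX.1, hX.2, hvC⟩
    · intro p hp
      simp only [mem_rootedSubsets, Finset.mem_product, Finset.subset_inter_iff] at hp ⊢
      exact ⟨Finset.union_subset hp.1.1.1 hp.2.1.1, Finset.mem_union_left _ hp.1.2⟩
    · intro X hX
      simp only [mem_rootedSubsets] at hX
      rw [← Finset.inter_union_distrib_left, Finset.inter_eq_left.2 (hX.1.trans hD)]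
    · rintro ⟨P, Q⟩ hp
      simp only [mem_rootedSubsets, Finset.mem_product, Finset.subset_inter_iff] at hp
      obtain ⟨⟨⟨_, hPB⟩, hvP⟩, ⟨_, hQC⟩, hvQ⟩ := hp
      have h1 : (P ∪ Q) ∩ B = P := by
        ext x
        have := hmem x
        have := @hPB x
        have := @hQC x
        simp only [Finset.mem_inter, Finset.mem_union]
        grind
      have h2 : (P ∪ Q) ∩ C = Q := by
        ext x
        have := hmem x
        have := @hPB x
        have := @hQC x
        simp only [Finset.mem_inter, Finset.mem_union]
        grind
      simp only [h1, h2]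
    · intro X hX
      simp only [mem_rootedSubsets] at hX
      have e1 : cutWeight w X (D \ X) = cutWeight w (X ∩ B) ((D ∩ B) \ (X ∩ B)) *
          cutWeight w (X ∩ C) ((D ∩ C) \ (X ∩ C)) := by
        have hDX : D \ X = ((D ∩ B) \ (X ∩ B)) ∪ ((D ∩ C) \ (X ∩ C)) := by
          ext x
          have := @hD x
          simp only [Finset.mem_union, Finset.mem_sdiff, Finset.mem_inter] at this ⊢
          tauto
        rw [hDX, cutWeight_union_right]
        · congr 1
          · rw [cutWeight_comm, cutWeight_comm w (X ∩ B),
              cutWeight_sdiff w _ (Finset.inter_subset_left : X ∩ B ⊆ X),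
              cutWeight_eq_one (Y := X \ _), mul_one]
            intro x hx y hy
            have := @hD y
            have := @hX.1 y
            simp only [Finset.mem_union, Finset.mem_sdiff, Finset.mem_inter] at *
            refine h x (by tauto) y (by tauto) ?_ ?_ <;> rintro rfl <;> tauto
          · rw [cutWeight_comm, cutWeight_comm w (X ∩ C),
              cutWeight_sdiff w _ (Finset.inter_subset_left : X ∩ C ⊆ X),
              cutWeight_eq_one (Y := X \ _), mul_one]
            intro x hx y hy
            have := @hD y
            have := @hX.1 y
            simp only [Finset.mem_union, Finset.mem_sdiff, Finset.mem_inter] at *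
            rw [Sym2.eq_swap]
            refine h y (by tauto) x (by tauto) ?_ ?_ <;> rintro rfl <;> tauto
        · rw [Finset.disjoint_left]
          intro x hx hx'
          have := hmem x
          simp only [Finset.mem_sdiff, Finset.mem_inter] at hx hx'
          have hxv := this.1 ⟨hx.1.2, hx'.1.2⟩
          rw [hxv] at hx
          tauto
      rw [e1]
      ring

/-- The weight of the event that `A` falls into two components that separate `u` from `v`. -/
noncomputable def splitWeight (w : Sym2 V → R) (u v : V) (A : Finset V) : R :=
  ∑ X ∈ (rootedSubsets u A).filter (v ∉ ·),
    connWeight w X * connWeight w (A \ X) * cutWeight w X (A \ X)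

/-- Both sides weigh the event that the component of `u` misses `v`. On the right, the component of
`v` is revealed as well, and terms are grouped by the union of the two components. -/
lemma sum_splitWeight_mul_cutWeight (w : Sym2 V → R) {u v : V} {A : Finset V} (hv : v ∈ A) :
    ∑ X ∈ (rootedSubsets u A).filter (v ∈ ·), splitWeight w u v X * cutWeight w X (A \ X) =
      ∑ X ∈ (rootedSubsets u A).filter (v ∉ ·), connWeight w X * cutWeight w X (A \ X) := by
  have e : ∀ X ∈ (rootedSubsets u A).filter (v ∉ ·), connWeight w X * cutWeight w X (A \ X) =
      ∑ Y ∈ ((rootedSubsets u A).filter (v ∈ ·)).filter (X ⊆ ·),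
        connWeight w X * connWeight w (Y \ X) * cutWeight w X (Y \ X) * cutWeight w Y (A \ Y) := by
    intro X hX
    simp only [Finset.mem_filter, mem_rootedSubsets] at hX
    have := connWeight_sum w (r := v) (A := A \ X) (by simp [hv, hX.2])
    rw [← mul_one (_ * cutWeight w X (A \ X)), ← this, Finset.mul_sum]
    refine Finset.sum_bij' (fun Y _ => X ∪ Y) (fun Y _ => Y \ X) ?_ ?_ ?_ ?_ ?_
    · intro Y hY
      simp only [mem_rootedSubsets, Finset.subset_sdiff] at hY
      simp only [Finset.mem_filter, mem_rootedSubsets]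
      exact ⟨⟨⟨Finset.union_subset hX.1.1 hY.1.1, by simp [hX.1.2]⟩, by simp [hY.2]⟩,
        Finset.subset_union_left⟩
    · intro Y hY
      simp only [Finset.mem_filter, mem_rootedSubsets] at hY
      simp only [mem_rootedSubsets, Finset.mem_sdiff]
      exact ⟨Finset.sdiff_subset_sdiff hY.1.1.1 subset_rfl, hY.1.2, hX.2⟩
    · intro Y hY
      simp only [mem_rootedSubsets, Finset.subset_sdiff] at hY
      exact Finset.union_sdiff_cancel_left hY.1.2.symm
    · intro Y hY
      simp only [Finset.mem_filter] at hY
      exact Finset.union_sdiff_of_subset hY.2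
    · intro Y hY
      simp only [mem_rootedSubsets] at hY
      have h' := cutWeight_mul_cutWeight w hY.1
      rw [Finset.union_sdiff_cancel_left (Finset.subset_sdiff.1 hY.1).2.symm]
      linear_combination connWeight w X * connWeight w Y * h'
  rw [Finset.sum_congr rfl e]
  rw [Finset.sum_comm' (t' := (rootedSubsets u A).filter (v ∈ ·))
        (s' := fun Y => (rootedSubsets u Y).filter (v ∉ ·))]
  · refine Finset.sum_congr rfl fun Y _ => ?_
    rw [splitWeight, Finset.sum_mul]
  · intro X Y
    simp only [Finset.mem_filter, mem_rootedSubsets]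
    constructor
    · tauto
    · rintro ⟨h1, h2⟩
      exact ⟨⟨⟨h1.1.1.trans h2.1.1, h1.1.2⟩, h1.2⟩, h2, h1.1.1⟩

/-- Merging the vertex `u` into `r`. -/
lemma connWeight_merge {w w' : Sym2 V → R} {r u : V} {A : Finset V} (hr : r ∈ A) (hu : u ∈ A)
    (hru : r ≠ u) (h1 : ∀ x ∈ A, x ≠ r → x ≠ u → w' s(r, x) = w s(r, x) * w s(u, x))
    (h2 : ∀ x ∈ A, ∀ y ∈ A, x ≠ r → x ≠ u → y ≠ r → y ≠ u → w' s(x, y) = w s(x, y)) :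
    connWeight w' (A.erase u) = connWeight w A + splitWeight w r u A := by
  have := eq_connWeight (w := w')
    (F := fun X => connWeight w (insert u X) + splitWeight w r u (insert u X)) (r := r)
    (A := A.erase u) (by simp [hr, hru]) ?_
  · rw [← this, Finset.insert_erase hu]
  intro B hB hrB
  have huB : u ∉ B := fun h => by simpa using hB h
  have hBA : ∀ x ∈ B, x ∈ A := fun x hx => Finset.mem_of_mem_erase (hB hx)
  have hsum : ∑ X ∈ rootedSubsets r B,
      (connWeight w (insert u X) + splitWeight w r u (insert u X)) * cutWeight w' X (B \ X) =
      ∑ X ∈ (rootedSubsets r (insert u B)).filter (u ∈ ·),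
        (connWeight w X + splitWeight w r u X) * cutWeight w X (insert u B \ X) := by
    refine Finset.sum_bij' (fun X _ => insert u X) (fun X _ => X.erase u) ?_ ?_ ?_ ?_ ?_
    · intro X hX
      simp only [mem_rootedSubsets] at hX
      simp only [Finset.mem_filter, mem_rootedSubsets]
      exact ⟨⟨Finset.insert_subset_insert u hX.1, by simp [hX.2]⟩, by simp⟩
    · intro X hX
      simp only [Finset.mem_filter, mem_rootedSubsets] at hX ⊢
      exact ⟨by rw [← Finset.subset_insert_iff]; exact hX.1.1, by simp [hru, hX.1.2]⟩
    · intro X hX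
      simp only [mem_rootedSubsets] at hX
      exact Finset.erase_insert fun h => huB (hX.1 h)
    · intro X hX
      simp only [Finset.mem_filter] at hX
      exact Finset.insert_erase hX.2
    · intro X hX
      simp only [mem_rootedSubsets] at hX
      have huX : u ∉ X := fun h => huB (hX.1 h)
      congr 1
      have hs : insert u B \ insert u X = B \ X := by
        ext x
        simp only [Finset.mem_sdiff, Finset.mem_insert]
        grind
      rw [hs, ← Finset.insert_erase hX.2]
      have hr' : r ∉ X.erase r := by simp
      have hu' : u ∉ insert r (X.erase r) := by rwa [Finset.insert_erase hX.2]
      unfold cutWeight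
      rw [Finset.prod_insert hu', Finset.prod_insert hr', Finset.prod_insert hr', ← mul_assoc,
        ← Finset.prod_mul_distrib]
      congr 1
      · refine Finset.prod_congr rfl fun y hy => ?_
        rw [Finset.insert_erase hX.2, Finset.mem_sdiff] at hy
        rw [h1 y (hBA y hy.1) (by rintro rfl; exact hy.2 hX.2) (by rintro rfl; exact huB hy.1),
          mul_comm]
      · refine Finset.prod_congr rfl fun x hx => Finset.prod_congr rfl fun y hy => ?_
        rw [Finset.insert_erase hX.2, Finset.mem_sdiff] at hy
        rw [Finset.mem_erase] at hx
        exact h2 x (hBA x (hX.1 hx.2)) y (hBA y hy.1) hx.1 (by rintro rfl; exact huX hx.2)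
          (by rintro rfl; exact hy.2 hX.2) (by rintro rfl; exact huB hy.1)
  have huB' : u ∈ insert u B := by simp
  rw [hsum]
  -- The split terms become the root components that miss `u`, exactly what completes the connection
  -- terms to the full recursion.
  simp only [add_mul, Finset.sum_add_distrib, sum_splitWeight_mul_cutWeight w huB']
  rw [Finset.sum_filter_add_sum_filter_not]
  exact connWeight_sum w (by simp [hrB])

/-- The weights after merging the vertex `u` into `r`. -/
def mergeWeight (w : Sym2 V → R) (r u : V) (e : Sym2 V) : R :=
  if r ∈ e then w e * w (e.map fun x => if x = r then u else x) else w e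

lemma connWeight_mergeWeight (w : Sym2 V → R) {r u : V} {A : Finset V} (hr : r ∈ A) (hu : u ∈ A)
    (hru : r ≠ u) :
    connWeight (mergeWeight w r u) (A.erase u) = connWeight w A + splitWeight w r u A := by
  refine connWeight_merge hr hu hru ?_ ?_
  · intro x _ hxr _
    simp [mergeWeight, hxr]
  · intro x _ y _ hxr _ hyr _
    simp [mergeWeight, hxr.symm, hyr.symm]

lemma splitWeight_congr {w w' : Sym2 V → R} {u v : V} {A : Finset V}
    (h : ∀ x ∈ A, ∀ y ∈ A, x ≠ y → w s(x, y) = w' s(x, y)) :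
    splitWeight w u v A = splitWeight w' u v A := by
  refine Finset.sum_congr rfl fun X hX => ?_
  simp only [Finset.mem_filter, mem_rootedSubsets] at hX
  rw [connWeight_congr fun x hx y hy => h x (hX.1.1 hx) y (hX.1.1 hy),
    connWeight_congr (A := A \ X)
      fun x hx y hy => h x (Finset.sdiff_subset hx) y (Finset.sdiff_subset hy),
    cutWeight_congr]
  intro x hx y hy
  rw [Finset.mem_sdiff] at hy
  exact h x (hX.1.1 hx) y hy.1 (by rintro rfl; exact hy.2 hx)

/-- The pair `s(u, v)` lies in every cut separating `u` from `v`, exactly once, and inside neither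
side. -/
lemma splitWeight_update (w : Sym2 V → R) {u v : V} {A : Finset V} (hv : v ∈ A) (t : R) :
    splitWeight (Function.update w s(u, v) t) u v A =
      t * splitWeight (Function.update w s(u, v) 1) u v A := by
  unfold splitWeight
  rw [Finset.mul_sum]
  refine Finset.sum_congr rfl fun X hX => ?_
  simp only [Finset.mem_filter, mem_rootedSubsets] at hX
  have hne : ∀ x y : V, s(x, y) ≠ s(u, v) → ∀ t, Function.update w s(u, v) t s(x, y) =
      Function.update w s(u, v) 1 s(x, y) := by
    intro x y h t
    simp [Function.update_of_ne h]
  rw [connWeight_congr (w' := Function.update w s(u, v) 1) (A := X) fun x hx y hy _ => hne x y ?_ t,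
    connWeight_congr (w' := Function.update w s(u, v) 1) (A := A \ X) fun x hx y hy _ => hne x y ?_ t]
  · have : cutWeight (Function.update w s(u, v) t) X (A \ X) =
        t * cutWeight (Function.update w s(u, v) 1) X (A \ X) := by
      unfold cutWeight
      have hvX : v ∈ A \ X := by simp [hv, hX.2]
      rw [← Finset.mul_prod_erase _ _ hX.1.2, ← Finset.mul_prod_erase X _ hX.1.2,
        ← Finset.mul_prod_erase _ _ hvX, ← Finset.mul_prod_erase _ _ hvX]
      simp only [Function.update_self, one_mul, mul_assoc]
      congr 2
      · refine Finset.prod_congr rfl fun y hy => hne u y ?_ t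
        rw [Finset.mem_erase] at hy
        simp only [ne_eq, Sym2.eq_iff]
        rintro (⟨-, h⟩ | ⟨h, h'⟩)
        · exact hy.1 h
        · exact hy.1 (h'.trans h)
      · refine Finset.prod_congr rfl fun x hx => Finset.prod_congr rfl fun y hy => hne x y ?_ t
        rw [Finset.mem_erase] at hx
        simp only [ne_eq, Sym2.eq_iff]
        rintro (⟨h, -⟩ | ⟨h, -⟩)
        · exact hx.1 h
        · exact hX.2 (h ▸ hx.2)
    rw [this]
    ring
  · simp only [ne_eq, Sym2.eq_iff]
    simp only [Finset.mem_sdiff] at hx hy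
    rintro (⟨rfl, -⟩ | ⟨-, rfl⟩)
    · exact hx.2 hX.1.2
    · exact hy.2 hX.1.2
  · simp only [ne_eq, Sym2.eq_iff]
    rintro (⟨-, rfl⟩ | ⟨rfl, -⟩)
    · exact hX.2 hy
    · exact hX.2 hx

/-- Deletion and contraction. -/
lemma connWeight_deletion_contraction (w : Sym2 V → R) {r u : V} {A : Finset V} (hr : r ∈ A)
    (hu : u ∈ A) (hru : r ≠ u) :
    connWeight w A = w s(r, u) * connWeight (Function.update w s(r, u) 1) A +
      (1 - w s(r, u)) * connWeight (mergeWeight w r u) (A.erase u) := by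
  have e1 := connWeight_mergeWeight w hr hu hru
  -- The merged weights do not see the pair `s(r, u)`, so the same merged graph also serves the
  -- deletion; the two split weights differ by the factor `w s(r, u)`, and eliminating them gives
  -- the formula.
  have e2 := connWeight_merge (w := Function.update w s(r, u) 1) (w' := mergeWeight w r u)
    hr hu hru ?_ ?_
  · have e3 := splitWeight_update w (u := r) hu (w s(r, u))
    rw [Function.update_eq_self] at e3
    rw [e3] at e1
    linear_combination (-1 : R) * e1 + w s(r, u) * e2
  · intro x _ hxr hxu
    have a1 : s(r, x) ≠ s(r, u) := by simp only [ne_eq, Sym2.eq_iff]; grind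
    have a2 : s(u, x) ≠ s(r, u) := by simp only [ne_eq, Sym2.eq_iff]; grind
    simp [mergeWeight, Function.update_of_ne a1, Function.update_of_ne a2, hxr]
  · intro x _ y _ hxr hxu hyr hyu
    have a1 : s(x, y) ≠ s(r, u) := by simp [hxr, hxu]
    simp [mergeWeight, Function.update_of_ne a1, hxr.symm, hyr.symm]

end ConnWeight

/-! ### Pieces in series, and affine dependence on each pair. -/

section Series

variable {V R : Type*} [DecidableEq V] [CommRing R]

lemma splitWeight_comm (w : Sym2 V → R) {u v : V} {A : Finset V} (hu : u ∈ A) (hv : v ∈ A) :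
    splitWeight w u v A = splitWeight w v u A := by
  unfold splitWeight
  refine Finset.sum_bij' (fun X _ => A \ X) (fun X _ => A \ X) ?_ ?_ ?_ ?_ ?_
  · intro X hX
    simp only [Finset.mem_filter, mem_rootedSubsets, Finset.mem_sdiff] at hX ⊢
    exact ⟨⟨Finset.sdiff_subset, hv, hX.2⟩, fun h => h.2 hX.1.2⟩
  · intro X hX
    simp only [Finset.mem_filter, mem_rootedSubsets, Finset.mem_sdiff] at hX ⊢
    exact ⟨⟨Finset.sdiff_subset, hu, hX.2⟩, fun h => h.2 hX.1.2⟩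
  · intro X hX
    simp only [Finset.mem_filter, mem_rootedSubsets] at hX
    exact Finset.sdiff_sdiff_eq_self hX.1.1
  · intro X hX
    simp only [Finset.mem_filter, mem_rootedSubsets] at hX
    exact Finset.sdiff_sdiff_eq_self hX.1.1
  · intro X hX
    simp only [Finset.mem_filter, mem_rootedSubsets] at hX
    rw [Finset.sdiff_sdiff_eq_self hX.1.1, cutWeight_comm w X]
    ring

/-- If the component X of `u` contains the cut vertex, it must contain all of B: otherwise the rest
consists of nonempty parts of B and C with no pair between them, hence has connection weight 0. What
remains is a split of C alone. -/
lemma sum_split_of_mem_left {w : Sym2 V → R} {B C : Finset V} {u v t : V} (hv : B ∩ C = {v})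
    (h : ∀ x ∈ B, ∀ y ∈ C, x ≠ v → y ≠ v → w s(x, y) = 1) (hu : u ∈ B) (ht : t ∈ C)
    (htv : t ≠ v) :
    ∑ X ∈ ((rootedSubsets u (B ∪ C)).filter (t ∉ ·)).filter (v ∈ ·),
      connWeight w X * connWeight w ((B ∪ C) \ X) * cutWeight w X ((B ∪ C) \ X) =
    connWeight w B * splitWeight w v t C := by
  have hmem : ∀ x, x ∈ B ∧ x ∈ C ↔ x = v := fun x => by
    rw [← Finset.mem_inter, hv, Finset.mem_singleton]
  have hvB := ((hmem v).2 rfl).1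
  have hvC := ((hmem v).2 rfl).2
  have htB : t ∉ B := fun h => htv ((hmem t).1 ⟨h, ht⟩)
  rw [splitWeight, Finset.mul_sum]
  rw [← Finset.sum_filter_add_sum_filter_not _ (B ⊆ ·)]
  have hz : ∑ X ∈ (((rootedSubsets u (B ∪ C)).filter (t ∉ ·)).filter (v ∈ ·)).filter (¬ B ⊆ ·),
      connWeight w X * connWeight w ((B ∪ C) \ X) * cutWeight w X ((B ∪ C) \ X) = 0 := by
    refine Finset.sum_eq_zero fun X hX => ?_
    simp only [Finset.mem_filter, mem_rootedSubsets] at hX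
    have := connWeight_union_eq_zero (w := w) (P := B \ X) (Q := C \ X) ?_ ⟨t, ?_⟩ ?_ ?_
    · rw [Finset.union_sdiff_distrib, this]
      ring
    · rw [Finset.sdiff_nonempty]
      exact hX.2
    · simp [ht, hX.1.1.2]
    · rw [Finset.disjoint_left]
      intro x hx hx'
      rw [Finset.mem_sdiff] at hx hx'
      rw [(hmem x).1 ⟨hx.1, hx'.1⟩] at hx
      exact hx.2 hX.1.2
    · intro x hx y hy
      rw [Finset.mem_sdiff] at hx hy
      exact h x hx.1 y hy.1 (by rintro rfl; exact hx.2 hX.1.2) (by rintro rfl; exact hy.2 hX.1.2)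
  rw [hz, add_zero]
  refine Finset.sum_bij' (fun X _ => X ∩ C) (fun Y _ => B ∪ Y) ?_ ?_ ?_ ?_ ?_
  · intro X hX
    simp only [Finset.mem_filter, mem_rootedSubsets, Finset.mem_inter] at hX ⊢
    exact ⟨⟨Finset.inter_subset_right, hX.1.2, hvC⟩, fun h => hX.1.1.2 h.1⟩
  · intro Y hY
    simp only [Finset.mem_filter, mem_rootedSubsets, Finset.mem_union] at hY ⊢
    exact ⟨⟨⟨⟨Finset.union_subset_union_right hY.1.1, Or.inl hu⟩, by tauto⟩, Or.inl hvB⟩,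
      Finset.subset_union_left⟩
  · intro X hX
    simp only [Finset.mem_filter, mem_rootedSubsets] at hX
    ext x
    have h1 := @hX.2 x
    have h2 := @hX.1.1.1.1 x
    simp only [Finset.mem_union, Finset.mem_inter] at h2 ⊢
    tauto
  · intro Y hY
    simp only [Finset.mem_filter, mem_rootedSubsets] at hY
    ext x
    have h1 := @hY.1.1 x
    have h2 := hmem x
    simp only [Finset.mem_union, Finset.mem_inter]
    grind
  · intro X hX
    simp only [Finset.mem_filter, mem_rootedSubsets] at hX
    obtain ⟨⟨⟨⟨hXs, huX⟩, htX⟩, hvX⟩, hBX⟩ := hX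
    have hXe : X = B ∪ (X ∩ C) := by
      ext x
      have h1 := @hBX x
      have h2 := @hXs x
      simp only [Finset.mem_union, Finset.mem_inter] at h2 ⊢
      tauto
    have e1 : (B ∪ C) \ X = C \ (X ∩ C) := by
      ext x
      have h1 := @hBX x
      simp only [Finset.mem_union, Finset.mem_inter, Finset.mem_sdiff]
      tauto
    have e2 : connWeight w X = connWeight w B * connWeight w (X ∩ C) := by
      nth_rw 1 [hXe]
      refine connWeight_union (v := v) ?_ fun x hx y hy => h x hx y (Finset.mem_inter.1 hy).2
      ext x
      have := hmem x
      simp only [Finset.mem_inter, Finset.mem_singleton]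
      grind
    have e3 : cutWeight w X (C \ (X ∩ C)) = cutWeight w (X ∩ C) (C \ (X ∩ C)) := by
      rw [cutWeight_comm, cutWeight_sdiff w _ (Finset.inter_subset_left : X ∩ C ⊆ X),
        cutWeight_eq_one (Y := X \ (X ∩ C)), mul_one, cutWeight_comm]
      intro x hx y hy
      have := @hXs y
      simp only [Finset.mem_sdiff, Finset.mem_inter, Finset.mem_union] at hx hy this
      rw [Sym2.eq_swap]
      refine h y (by tauto) x (by tauto) ?_ ?_ <;> rintro rfl <;> tauto
    rw [e1, e2, e3]
    ring

/-- The split weight of two pieces in series. -/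
lemma splitWeight_union {w : Sym2 V → R} {B C : Finset V} {u v t : V} (hv : B ∩ C = {v})
    (h : ∀ x ∈ B, ∀ y ∈ C, x ≠ v → y ≠ v → w s(x, y) = 1) (hu : u ∈ B) (ht : t ∈ C)
    (huv : u ≠ v) (htv : t ≠ v) :
    splitWeight w u t (B ∪ C) =
      splitWeight w u v B * connWeight w C + connWeight w B * splitWeight w v t C := by
  have hvm : v ∈ B ∩ C := by simp [hv]
  rw [Finset.mem_inter] at hvm
  rw [splitWeight, ← Finset.sum_filter_add_sum_filter_not _ (v ∈ ·),
    sum_split_of_mem_left hv h hu ht htv, add_comm, splitWeight_comm w hu hvm.1, mul_comm (splitWeight _ _ _ _)]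
  congr 1
  -- If the cut vertex lies on the side of `t`, exchange the two pieces and pass to complements.
  rw [← sum_split_of_mem_left (B := C) (C := B) (by rwa [Finset.inter_comm])
    (fun x hx y hy hxv hyv => by rw [Sym2.eq_swap]; exact h y hy x hx hyv hxv) ht hu huv,
    Finset.union_comm C B]
  refine Finset.sum_bij' (fun X _ => (B ∪ C) \ X) (fun X _ => (B ∪ C) \ X) ?_ ?_ ?_ ?_ ?_
  · intro X hX
    simp only [Finset.mem_filter, mem_rootedSubsets, Finset.mem_sdiff, Finset.mem_union] at hX ⊢
    exact ⟨⟨⟨Finset.sdiff_subset, by tauto⟩, by tauto⟩, by tauto⟩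
  · intro X hX
    simp only [Finset.mem_filter, mem_rootedSubsets, Finset.mem_sdiff, Finset.mem_union] at hX ⊢
    exact ⟨⟨⟨Finset.sdiff_subset, by tauto⟩, by tauto⟩, by tauto⟩
  · intro X hX
    simp only [Finset.mem_filter, mem_rootedSubsets] at hX
    exact Finset.sdiff_sdiff_eq_self hX.1.1.1
  · intro X hX
    simp only [Finset.mem_filter, mem_rootedSubsets] at hX
    exact Finset.sdiff_sdiff_eq_self hX.1.1.1
  · intro X hX
    simp only [Finset.mem_filter, mem_rootedSubsets] at hX
    rw [Finset.sdiff_sdiff_eq_self hX.1.1.1, cutWeight_comm w X]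
    ring

/-- The connection weight is affine in the weight of each pair. -/
lemma connWeight_affine (w : Sym2 V → R) (A : Finset V) {e : Sym2 V} (he : ¬ e.IsDiag) :
    connWeight w A = w e * connWeight (Function.update w e 1) A +
      (1 - w e) * connWeight (Function.update w e 0) A := by
  induction e with
  | h r u =>
    have hru : r ≠ u := by simpa using he
    by_cases hm : r ∈ A ∧ u ∈ A
    · have h1 := connWeight_deletion_contraction (Function.update w s(r, u) 0) hm.1 hm.2 hru
      rw [connWeight_deletion_contraction w hm.1 hm.2 hru, h1]
      simp only [Function.update_self, zero_mul, zero_add, sub_zero, one_mul]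
      congr 2
      refine connWeight_congr fun x hx y hy _ => ?_
      rw [Finset.mem_erase] at hx hy
      unfold mergeWeight
      have a1 : s(x, y) ≠ s(r, u) := by simp [hx.1, hy.1]
      rw [Function.update_of_ne a1]
      split_ifs with hr
      · rw [Function.update_of_ne]
        rw [Sym2.mem_iff] at hr
        rcases hr with rfl | rfl
        · simp only [Sym2.map_mk]
          grind
        · simp only [Sym2.map_mk]
          grind
      · rfl
    · have key : ∀ t, connWeight (Function.update w s(r, u) t) A = connWeight w A := by
        intro t
        refine connWeight_congr fun x hx y hy _ => ?_
        rw [Function.update_of_ne]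
        simp only [ne_eq, Sym2.eq_iff]
        rintro (⟨rfl, rfl⟩ | ⟨rfl, rfl⟩) <;> tauto
      rw [key, key]
      ring

end Series

/-! ### Complete graphs with constant weight. -/

section Clique

variable {V R : Type*} [CommRing R]

lemma cutWeight_const (q : R) (X Y : Finset V) :
    cutWeight (fun _ => q) X Y = q ^ (X.card * Y.card) := by
  simp [cutWeight, ← pow_mul, mul_comm]

variable [DecidableEq V]

/-- The reliability of the complete graph on `N` vertices (with value `1` for `N = 0`). -/
def cliqueRel (q : R) : ℕ → R
  | 0 => 1
  | N + 1 => 1 - ∑ j : Fin N, N.choose j * cliqueRel q (j + 1) * q ^ ((j + 1) * (N - j) : ℕ)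
decreasing_by omega

/-- The cofactor of `q ^ (M + 1)` in the split weight of the complete graph on `M + 2` vertices. -/
def cliqueSplit (q : R) (M : ℕ) : R :=
  ∑ j ∈ Finset.range (M + 1),
    M.choose j * (cliqueRel q (j + 1) * cliqueRel q (M + 1 - j)) * q ^ (j * (M - j))

lemma cliqueRel_succ (q : R) (N : ℕ) : cliqueRel q (N + 1) =
    1 - ∑ j ∈ Finset.range N, N.choose j * cliqueRel q (j + 1) * q ^ ((j + 1) * (N - j)) := by
  rw [cliqueRel, Finset.sum_range]

lemma cliqueRel_sum (q : R) (N : ℕ) :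
    ∑ j ∈ Finset.range (N + 1), N.choose j * cliqueRel q (j + 1) * q ^ ((j + 1) * (N - j)) = 1 := by
  rw [Finset.sum_range_succ, cliqueRel_succ q N]
  simp

lemma sum_rootedSubsets {r : V} {A : Finset V} (hr : r ∈ A) (f : Finset V → R) :
    ∑ X ∈ rootedSubsets r A, f X = ∑ Y ∈ (A.erase r).powerset, f (insert r Y) := by
  refine Finset.sum_bij' (fun X _ => X.erase r) (fun Y _ => insert r Y) ?_ ?_ ?_ ?_ ?_
  · intro X hX
    simp only [mem_rootedSubsets, Finset.mem_powerset] at hX ⊢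
    exact Finset.erase_subset_erase r hX.1
  · intro Y hY
    simp only [mem_rootedSubsets, Finset.mem_powerset] at hY ⊢
    exact ⟨Finset.insert_subset hr (hY.trans (Finset.erase_subset _ _)), by simp⟩
  · intro X hX
    simp only [mem_rootedSubsets] at hX
    exact Finset.insert_erase hX.2
  · intro Y hY
    rw [Finset.mem_powerset] at hY
    exact Finset.erase_insert fun h => by simpa using hY h
  · intro X hX
    simp only [mem_rootedSubsets] at hX
    rw [Finset.insert_erase hX.2]

lemma connWeight_const (q : R) {A : Finset V} (hA : A.Nonempty) :
    connWeight (fun _ => q) A = cliqueRel q A.card := by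
  obtain ⟨r, hr⟩ := hA
  symm
  refine eq_connWeight (F := fun A => cliqueRel q A.card) hr fun B hB hrB => ?_
  rw [sum_rootedSubsets hrB]
  have hc : (B.erase r).card + 1 = B.card := Finset.card_erase_add_one hrB
  rw [← cliqueRel_sum q (B.erase r).card]
  have := Finset.sum_powerset_apply_card
    (fun j => cliqueRel q (j + 1) * q ^ ((j + 1) * ((B.erase r).card - j)))
    (x := B.erase r)
  simp only [nsmul_eq_mul, ← mul_assoc] at this
  rw [← this]
  refine Finset.sum_congr rfl fun Y hY => ?_
  rw [Finset.mem_powerset] at hY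
  have hrY : r ∉ Y := fun h => by simpa using hY h
  have hi : insert r Y ⊆ B := Finset.insert_subset hrB (hY.trans (Finset.erase_subset _ _))
  rw [cutWeight_const, Finset.card_sdiff_of_subset hi, Finset.card_insert_of_notMem hrY, ← hc]
  congr 3
  omega

/-- The component of `u` has j + 1 vertices, j of them chosen among the M non-terminals. Its cut has
(j + 1)(M + 1 - j) = (M + 1) + j(M - j) pairs, which is where the factor q^(M + 1) comes from. -/
lemma splitWeight_const (q : R) {u v : V} {A : Finset V} {M : ℕ} (hu : u ∈ A) (hv : v ∈ A)
    (huv : u ≠ v) (hA : A.card = M + 2) :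
    splitWeight (fun _ => q) u v A = q ^ (M + 1) * cliqueSplit q M := by
  have hset : (rootedSubsets u A).filter (v ∉ ·) = rootedSubsets u (A.erase v) := by
    ext X
    simp only [Finset.mem_filter, mem_rootedSubsets, Finset.subset_erase]
    tauto
  have huA : u ∈ A.erase v := by simp [hu, huv]
  have hc : ((A.erase v).erase u).card = M := by
    rw [Finset.card_erase_of_mem huA, Finset.card_erase_of_mem hv, hA]
    rfl
  rw [splitWeight, hset, sum_rootedSubsets huA]
  have := Finset.sum_powerset_apply_card (fun j => (cliqueRel q (j + 1) * cliqueRel q (M + 1 - j)) *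
    q ^ ((j + 1) * (M + 1 - j))) (x := (A.erase v).erase u)
  rw [hc] at this
  simp only [nsmul_eq_mul] at this
  trans ∑ Y ∈ ((A.erase v).erase u).powerset,
    (cliqueRel q (Y.card + 1) * cliqueRel q (M + 1 - Y.card)) *
    q ^ ((Y.card + 1) * (M + 1 - Y.card))
  · refine Finset.sum_congr rfl fun Y hY => ?_
    rw [Finset.mem_powerset] at hY
    have huY : u ∉ Y := fun h => by simpa using hY h
    have hvY : v ∉ insert u Y := fun h => by
      rcases Finset.mem_insert.1 h with h | h
      · exact huv h.symm
      · simpa using hY h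
    have hi : insert u Y ⊆ A := Finset.insert_subset hu
      (hY.trans ((Finset.erase_subset _ _).trans (Finset.erase_subset _ _)))
    have hle := Finset.card_le_card hY
    rw [hc] at hle
    rw [connWeight_const q ⟨u, by simp⟩, connWeight_const q ⟨v, by simp only [Finset.mem_sdiff]; exact ⟨hv, hvY⟩⟩,
      cutWeight_const,
      Finset.card_sdiff_of_subset hi, Finset.card_insert_of_notMem huY, hA]
    have : M + 2 - (Y.card + 1) = M + 1 - Y.card := by omega
    rw [this]
  · rw [this, cliqueSplit, Finset.mul_sum]
    refine Finset.sum_congr rfl fun j hj => ?_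
    rw [Finset.mem_range] at hj
    obtain ⟨k, rfl⟩ : ∃ k, M = j + k := ⟨M - j, by omega⟩
    have h1 : j + k + 1 - j = k + 1 := by omega
    have h2 : j + k - j = k := by omega
    rw [h1, h2]
    ring

end Clique

/-! ### Chains of cliques. -/

section Chain

variable {R : Type*} [CommRing R]

open scoped Classical in
/-- The weights of the infinite chain of cliques on the blocks `[i * n, (i + 1) * n]` of `ℕ`. -/
noncomputable def chainWeight (q : R) (n : ℕ) (e : Sym2 ℕ) : R :=
  if ∃ i, ∀ x ∈ e, i * n ≤ x ∧ x ≤ (i + 1) * n then q else 1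

lemma chainWeight_eq (q : R) (n : ℕ) {m x y : ℕ} (hx : x ∈ Finset.Icc (m * n) ((m + 1) * n))
    (hy : y ∈ Finset.Icc (m * n) ((m + 1) * n)) : chainWeight q n s(x, y) = q := by
  rw [Finset.mem_Icc] at hx hy
  rw [chainWeight, if_pos]
  refine ⟨m, ?_⟩
  simp [hx, hy]

lemma chainWeight_eq_one (q : R) {n m x y : ℕ} (hx : x < m * n) (hy : m * n < y) :
    chainWeight q n s(x, y) = 1 := by
  rw [chainWeight, if_neg]
  rintro ⟨i, hi⟩
  have h1 := (hi x (by simp)).1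
  have h2 := (hi y (by simp)).2
  have h3 : i < m := lt_of_mul_lt_mul_right (h1.trans_lt hx) (Nat.zero_le n)
  have h4 : (i + 1) * n ≤ m * n := Nat.mul_le_mul_right n h3
  omega

lemma chain_union (m n : ℕ) : Finset.range ((m + 1) * n + 1) =
    Finset.range (m * n + 1) ∪ Finset.Icc (m * n) ((m + 1) * n) := by
  ext x
  simp only [Finset.mem_range, Finset.mem_union, Finset.mem_Icc, add_mul]
  omega

lemma chain_inter (m n : ℕ) :
    Finset.range (m * n + 1) ∩ Finset.Icc (m * n) ((m + 1) * n) = {m * n} := by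
  ext x
  simp only [Finset.mem_range, Finset.mem_inter, Finset.mem_Icc, Finset.mem_singleton, add_mul]
  omega

lemma chain_cross (q : R) (m n : ℕ) : ∀ x ∈ Finset.range (m * n + 1),
    ∀ y ∈ Finset.Icc (m * n) ((m + 1) * n), x ≠ m * n → y ≠ m * n →
    chainWeight q n s(x, y) = 1 := by
  intro x hx y hy h1 h2
  simp only [Finset.mem_range, Finset.mem_Icc] at hx hy
  exact chainWeight_eq_one q (m := m) (by omega) (by omega)

lemma connWeight_block (q : R) (m n : ℕ) :
    connWeight (chainWeight q n) (Finset.Icc (m * n) ((m + 1) * n)) = cliqueRel q (n + 1) := by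
  rw [connWeight_congr (w' := fun _ => q) fun x hx y hy _ => chainWeight_eq q n hx hy,
    connWeight_const q ⟨m * n, by simp [add_mul]⟩]
  congr 1
  rw [Nat.card_Icc, add_mul]
  omega

lemma splitWeight_block (q : R) (m M : ℕ) :
    splitWeight (chainWeight q (M + 1)) (m * (M + 1)) ((m + 1) * (M + 1))
      (Finset.Icc (m * (M + 1)) ((m + 1) * (M + 1))) = q ^ (M + 1) * cliqueSplit q M := by
  rw [splitWeight_congr (w' := fun _ => q) fun x hx y hy _ => chainWeight_eq q _ hx hy]
  have : m * (M + 1) < (m + 1) * (M + 1) := by rw [add_mul m 1]; omega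
  refine splitWeight_const q ?_ ?_ this.ne ?_
  · simp [this.le]
  · simp [this.le]
  · rw [Nat.card_Icc, add_mul m 1]
    omega

lemma connWeight_chain (q : R) (m n : ℕ) :
    connWeight (chainWeight q n) (Finset.range (m * n + 1)) = cliqueRel q (n + 1) ^ m := by
  induction m with
  | zero => simp [connWeight_singleton]
  | succ m ih =>
    rw [chain_union, connWeight_union (chain_inter m n) (chain_cross q m n), ih, connWeight_block,
      pow_succ]

/-- A split separating the ends of the chain takes place in exactly one of its m + 1 cliques, while
the others stay connected. -/
lemma splitWeight_chain (q : R) (m M : ℕ) :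
    splitWeight (chainWeight q (M + 1)) 0 ((m + 1) * (M + 1))
      (Finset.range ((m + 1) * (M + 1) + 1)) =
    (m + 1) * cliqueRel q (M + 2) ^ m * (q ^ (M + 1) * cliqueSplit q M) := by
  induction m with
  | zero =>
    have := splitWeight_block q 0 M
    simp only [zero_mul, zero_add, one_mul] at this ⊢
    rw [Finset.range_eq_Ico]
    have h : Finset.Ico 0 (M + 1 + 1) = Finset.Icc 0 (M + 1) := by
      ext x
      simp only [Finset.mem_Ico, Finset.mem_Icc]
      omega
    rw [h, this]
    simp
  | succ m ih =>
    have hlt : (m + 1) * (M + 1) < (m + 1 + 1) * (M + 1) := by rw [add_mul (m + 1) 1]; omega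
    rw [chain_union, splitWeight_union (chain_inter (m + 1) (M + 1)) (chain_cross q (m + 1) (M + 1))
      (by simp) (by simp [hlt.le]) (by simp) hlt.ne', ih,
      connWeight_block, connWeight_chain, splitWeight_block]
    push_cast
    ring

end Chain

/-! ### From connection weights to reliability. -/

section Interface

variable {V R : Type*}

lemma exists_adj_of_connected {H : SimpleGraph V} (hH : H.Connected) {X : Finset V} {r t : V}
    (hr : r ∈ X) (ht : t ∉ X) : ∃ x ∈ X, ∃ y ∉ X, H.Adj x y := by
  obtain ⟨p⟩ := hH.preconnected r t
  obtain ⟨d, -, h1, h2⟩ := p.exists_boundary_dart (X : Set V) hr ht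
  exact ⟨d.fst, h1, d.snd, h2, d.adj⟩

variable [DecidableEq V] [CommRing R]

/-- Affinity is applied to the pairs of `E` one at a time; `T` stores the pairs already decided to
be present. Weight 0 means surely present, weight 1 surely absent. -/
lemma connWeight_expand (q : R) (A : Finset V) (E : Finset (Sym2 V)) (hE : ∀ e ∈ E, ¬ e.IsDiag)
    (T : Finset (Sym2 V)) (hT : Disjoint E T) :
    connWeight (fun e => if e ∈ E then q else if e ∈ T then 0 else 1) A =
      ∑ S ∈ E.powerset, (1 - q) ^ S.card * q ^ (E.card - S.card) *
        connWeight (fun e => if e ∈ S ∪ T then 0 else 1) A := by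
  induction E using Finset.induction_on generalizing T with
  | empty => simp
  | insert a E ha ih =>
    have hE' : ∀ e ∈ E, ¬ e.IsDiag := fun e he => hE e (Finset.mem_insert_of_mem he)
    rw [Finset.disjoint_insert_left] at hT
    rw [Finset.sum_powerset_insert ha, connWeight_affine _ A (hE a (Finset.mem_insert_self a E))]
    have e1 : Function.update
        (fun e => if e ∈ insert a E then q else if e ∈ T then (0 : R) else 1) a 1 =
        fun e => if e ∈ E then q else if e ∈ T then (0 : R) else 1 := by
      funext e
      by_cases h : e = a
      · subst h
        simp [ha, hT.1]
      · simp [h]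
    have e2 : Function.update
        (fun e => if e ∈ insert a E then q else if e ∈ T then (0 : R) else 1) a 0 =
        fun e => if e ∈ E then q else if e ∈ insert a T then (0 : R) else 1 := by
      funext e
      by_cases h : e = a
      · subst h
        simp [ha]
      · simp [h]
    rw [e1, e2, ih hE' T hT.2, ih hE' (insert a T) (by simp [ha, hT.2]), Finset.mul_sum,
      Finset.mul_sum]
    simp only [Finset.mem_insert_self, if_true]
    congr 1
    · refine Finset.sum_congr rfl fun S hS => ?_
      have := Finset.card_le_card (Finset.mem_powerset.1 hS)
      rw [Finset.card_insert_of_notMem ha, Nat.succ_sub this, pow_succ]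
      ring
    · refine Finset.sum_congr rfl fun S hS => ?_
      have haS : a ∉ S := fun h => ha (Finset.mem_powerset.1 hS h)
      rw [Finset.card_insert_of_notMem ha, Finset.card_insert_of_notMem haS, Nat.succ_sub_succ,
        pow_succ, Finset.union_insert, Finset.insert_union]
      ring

-- For a connected graph every proper rooted set is left by an edge of weight 0, so only X = V
-- survives in the recursion. Otherwise, the vertices reachable from the root and the remaining ones
-- have no edge between them.
open scoped Classical in
lemma connWeight_indicator [Fintype V] [Nonempty V] (S : Finset (Sym2 V)) :
    connWeight (fun e => if e ∈ S then (0 : R) else 1) Finset.univ =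
      if (SimpleGraph.fromEdgeSet (S : Set (Sym2 V))).Connected then 1 else 0 := by
  obtain ⟨r⟩ := ‹Nonempty V›
  split_ifs with h
  · have hs := connWeight_sum (fun e => if e ∈ S then (0 : R) else 1) (Finset.mem_univ r)
    rw [Finset.sum_eq_single Finset.univ] at hs
    · simpa using hs
    · intro X hX hne
      rw [mem_rootedSubsets] at hX
      obtain ⟨t, ht⟩ : ∃ t, t ∉ X := by
        by_contra! hc
        exact hne (Finset.eq_univ_iff_forall.2 hc)
      obtain ⟨x, hx, y, hy, hxy⟩ := exists_adj_of_connected h hX.2 ht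
      rw [cutWeight_eq_zero hx (y := y) (by simp [hy]), mul_zero]
      rw [SimpleGraph.fromEdgeSet_adj] at hxy
      rw [if_pos (by simpa using hxy.1)]
    · simp
  · set H := SimpleGraph.fromEdgeSet (S : Set (Sym2 V)) with hH
    have hne : ∃ t, ¬ H.Reachable r t := by
      by_contra! hc
      exact h { preconnected := fun x y => (hc x).symm.trans (hc y), nonempty := ⟨r⟩ }
    obtain ⟨t, ht⟩ := hne
    have hu : (Finset.univ : Finset V) = Finset.univ.filter (H.Reachable r ·) ∪
        Finset.univ.filter (¬ H.Reachable r ·) := (Finset.filter_union_filter_not_eq _ _).symm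
    rw [hu]
    refine connWeight_union_eq_zero ⟨r, by simp⟩ ⟨t, by simpa using ht⟩
      (Finset.disjoint_filter_filter_not _ _ _) ?_
    intro x hx y hy
    simp only [Finset.mem_filter, Finset.mem_univ, true_and] at hx hy
    rw [if_neg]
    intro hxy
    refine hy (hx.trans (SimpleGraph.Adj.reachable ?_))
    rw [hH, SimpleGraph.fromEdgeSet_adj]
    exact ⟨hxy, by rintro rfl; exact hy hx⟩

open scoped Classical in
lemma reliability_eq_connWeight [Fintype V] [Nonempty V] (G : SimpleGraph V) (q : R) :
    reliability G q = connWeight (fun e => if e ∈ G.edgeSet then q else 1) Finset.univ := by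
  have h := connWeight_expand q Finset.univ G.edgeFinset
    (fun e he => G.not_isDiag_of_mem_edgeFinset he) ∅ (by simp)
  simp only [SimpleGraph.mem_edgeFinset, Finset.notMem_empty, if_false, Finset.union_empty] at h
  rw [h, reliability, Finset.sum_filter]
  refine Finset.sum_congr rfl fun S _ => ?_
  rw [connWeight_indicator]
  split_ifs <;> simp

end Interface

/-! ### Closing the chain into the cycle of cliques. -/

section Cycle

variable {R : Type*} [CommRing R]

/-- The position on the chain of cliques of a vertex of the cycle of cliques. -/
def chainPosition (m n : ℕ) : Fin m × Fin n ↪ ℕ where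
  toFun x := x.1 * n + x.2
  inj' := by
    rintro ⟨i, j⟩ ⟨k, l⟩ h
    have hn : 0 < n := j.pos
    have h1 : (i : ℕ) = k := by
      have := congrArg (· / n) h
      simpa [Nat.mul_add_div hn, mul_comm _ n, Nat.div_eq_of_lt] using this
    have h2 : (j : ℕ) = l := by
      simp only [h1] at h
      omega
    ext <;> simp [h1, h2]

lemma chainPosition_apply {m n : ℕ} (x : Fin m × Fin n) : chainPosition m n x = x.1 * n + x.2 :=
  rfl

lemma map_chainPosition (m n : ℕ) (hn : 1 ≤ n) :
    Finset.univ.map (chainPosition m n) = Finset.range (m * n) := by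
  ext x
  simp only [Finset.mem_map, Finset.mem_univ, true_and, Finset.mem_range]
  constructor
  · rintro ⟨⟨i, j⟩, rfl⟩
    have h : ((i : ℕ) + 1) * n ≤ m * n := Nat.mul_le_mul_right n i.2
    have := j.2
    rw [chainPosition_apply]
    rw [add_mul] at h
    dsimp only at *
    omega
  · intro hx
    refine ⟨(⟨x / n, (Nat.div_lt_iff_lt_mul hn).2 hx⟩, ⟨x % n, Nat.mod_lt _ hn⟩), ?_⟩
    simpa [chainPosition_apply] using Nat.div_add_mod' x n

lemma block_iff {n i k l : ℕ} (hl : l < n) :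
    (i * n ≤ k * n + l ∧ k * n + l ≤ (i + 1) * n) ↔ k = i ∨ (k = i + 1 ∧ l = 0) := by
  constructor
  · rintro ⟨h1, h2⟩
    have h3 : i < k + 1 := by
      refine lt_of_mul_lt_mul_right (h1.trans_lt ?_) (Nat.zero_le n)
      rw [add_mul]
      omega
    rcases (Nat.lt_succ_iff.1 h3).eq_or_lt with h | h
    · exact Or.inl h.symm
    · refine Or.inr ?_
      have h4 : (i + 1) * n ≤ k * n := Nat.mul_le_mul_right n h
      have h5 : k ≤ i + 1 := le_of_mul_le_mul_right (by omega : k * n ≤ (i + 1) * n) (by omega)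
      exact ⟨by omega, by omega⟩
  · rintro (rfl | ⟨rfl, rfl⟩)
    · rw [add_mul]
      omega
    · rw [add_mul]
      omega

/-- In chain coordinates two vertices are adjacent if they share a block; the only additional edges
arise from the last block, whose far end m n has become 0. -/
lemma cycleOfCliques_adj_iff {m n : ℕ} (hm : 3 ≤ m) (x y : Fin m × Fin n) (hxy : x ≠ y) :
    (cycleOfCliques m n).Adj x y ↔
      (∃ i, ∀ z ∈ s(chainPosition m n x, chainPosition m n y), i * n ≤ z ∧ z ≤ (i + 1) * n) ∨
      (chainPosition m n x = 0 ∧ (y.1 : ℕ) = m - 1) ∨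
      (chainPosition m n y = 0 ∧ (x.1 : ℕ) = m - 1) := by
  obtain ⟨⟨i, hi⟩, ⟨j, hj⟩⟩ := x
  obtain ⟨⟨k, hk⟩, ⟨l, hl⟩⟩ := y
  have hn : n ≠ 0 := by omega
  simp only [cycleOfCliques, cliqueBlock, Set.mem_ofPred_eq, chainPosition_apply,
    Sym2.mem_iff, forall_eq_or_imp, forall_eq, block_iff hj,
    block_iff hl, Nat.add_eq_zero_iff, mul_eq_zero, hn, or_false]
  have hmod : ∀ t < m, (t + 1) % m = if t = m - 1 then 0 else t + 1 := by
    intro t ht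
    split_ifs with h
    · rw [h, Nat.sub_add_cancel (by omega), Nat.mod_self]
    · exact Nat.mod_eq_of_lt (by omega)
  constructor
  · rintro ⟨-, ⟨t, ht⟩, h⟩
    rw [hmod t ht] at h
    simp only [Fin.mk.injEq] at h
    by_cases hc : t = m - 1
    · rw [if_pos hc] at h
      rcases h with ⟨rfl | h1, rfl | h2⟩
      · exact Or.inl ⟨_, Or.inl rfl, Or.inl rfl⟩
      · exact Or.inr (Or.inr ⟨h2, hc⟩)
      · exact Or.inr (Or.inl ⟨h1, hc⟩)
      · obtain ⟨rfl, rfl⟩ := h1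
        obtain ⟨rfl, rfl⟩ := h2
        exact absurd rfl hxy
    · rw [if_neg hc] at h
      exact Or.inl ⟨t, h⟩
  · rintro (⟨t, h1, h2⟩ | ⟨h1, h2⟩ | ⟨h1, h2⟩)
    · by_cases ht : t < m
      · refine ⟨hxy, ⟨t, ht⟩, ?_⟩
        rw [hmod t ht]
        simp only [Fin.mk.injEq]
        by_cases hc : t = m - 1
        · rw [if_pos hc]
          constructor <;> left <;> omega
        · rw [if_neg hc]
          exact ⟨h1, h2⟩
      · omega
    · refine ⟨hxy, ⟨m - 1, by omega⟩, ?_⟩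
      rw [hmod _ (by omega)]
      simp only [Fin.mk.injEq]
      exact ⟨Or.inr (by simpa using h1), Or.inl h2⟩
    · refine ⟨hxy, ⟨m - 1, by omega⟩, ?_⟩
      rw [hmod _ (by omega)]
      simp only [Fin.mk.injEq]
      exact ⟨Or.inl h2, Or.inr (by simpa using h1)⟩

-- The merged weight is the product of the weights towards 0 and towards m n. Since m ≥ 3, no vertex
-- is adjacent to both of these points of the chain, so q² never occurs.
open scoped Classical in
lemma mergeWeight_chainWeight_zero {m n : ℕ} (hm : 3 ≤ m) (hn : 1 ≤ n) (q : R)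
    (y : Fin m × Fin n) (hy : chainPosition m n y ≠ 0) :
    mergeWeight (chainWeight q n) 0 (m * n) s(0, chainPosition m n y) =
      if (∃ i, ∀ z ∈ s(0, chainPosition m n y), i * n ≤ z ∧ z ≤ (i + 1) * n) ∨ (y.1 : ℕ) = m - 1
      then q else 1 := by
  obtain ⟨⟨k, hk⟩, ⟨l, hl⟩⟩ := y
  simp only [mergeWeight, Sym2.mem_iff, true_or, if_true, Sym2.map_mk, if_neg hy]
  simp only [chainPosition_apply] at *
  have e1 : ∀ i, (i * n ≤ 0 ∧ 0 ≤ (i + 1) * n) ↔ i = 0 := by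
    intro i
    simp only [Nat.le_zero, mul_eq_zero, Nat.zero_le, and_true]
    omega
  have e2 : ∀ i, (i * n ≤ m * n ∧ m * n ≤ (i + 1) * n) ↔ m = i ∨ m = i + 1 := by
    intro i
    simpa using block_iff (i := i) (k := m) (l := 0) hn
  simp only [chainWeight, Sym2.mem_iff, forall_eq_or_imp, forall_eq, e1, e2, block_iff hl]
  have c1 : (∃ i, i = 0 ∧ (k = i ∨ k = i + 1 ∧ l = 0)) ↔ (k = 0 ∨ k = 1 ∧ l = 0) := by simp
  have c2 : (∃ i, (m = i ∨ m = i + 1) ∧ (k = i ∨ k = i + 1 ∧ l = 0)) ↔ k = m - 1 := by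
    constructor
    · rintro ⟨i, h⟩
      omega
    · rintro rfl
      exact ⟨m - 1, by omega⟩
  rw [if_congr c1 rfl rfl, if_congr c2 rfl rfl, if_congr (or_congr c1 Iff.rfl) rfl rfl]
  split_ifs <;> first | omega | simp

/-- The reliability of the graph `C_m[K_{n+1}]`. -/
theorem reliability_cycleOfCliques (m M : ℕ) (hm : 2 ≤ m) (q : R) :
    reliability (cycleOfCliques (m + 1) (M + 1)) q =
      cliqueRel q (M + 2) ^ m *
        (cliqueRel q (M + 2) + (m + 1) * (q ^ (M + 1) * cliqueSplit q M)) := by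
  classical
  rw [reliability_eq_connWeight]
  have hpos : 0 < (m + 1) * (M + 1) := by positivity
  have h := connWeight_mergeWeight (chainWeight q (M + 1)) (r := 0) (u := (m + 1) * (M + 1))
    (A := Finset.range ((m + 1) * (M + 1) + 1)) (by simp) (by simp) hpos.ne
  rw [connWeight_chain, splitWeight_chain] at h
  have he : (Finset.range ((m + 1) * (M + 1) + 1)).erase ((m + 1) * (M + 1)) =
      Finset.univ.map (chainPosition (m + 1) (M + 1)) := by
    rw [map_chainPosition _ _ (by omega), Finset.range_add_one, Finset.erase_insert (by simp)]
  rw [he, connWeight_map] at h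
  trans cliqueRel q (M + 2) ^ (m + 1) +
    (m + 1) * cliqueRel q (M + 2) ^ m * (q ^ (M + 1) * cliqueSplit q M)
  · rw [← h]
    refine connWeight_congr fun x _ y _ hxy => ?_
    have hadj := cycleOfCliques_adj_iff (by omega : 3 ≤ m + 1) x y hxy
    rw [if_congr (SimpleGraph.mem_edgeSet _) rfl rfl, if_congr hadj rfl rfl, Sym2.map_mk]
    have hne : chainPosition (m + 1) (M + 1) x ≠ chainPosition (m + 1) (M + 1) y :=
      fun h => hxy ((chainPosition _ _).injective h)
    by_cases hx : chainPosition (m + 1) (M + 1) x = 0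
    · have hy : chainPosition (m + 1) (M + 1) y ≠ 0 := by omega
      rw [hx, mergeWeight_chainWeight_zero (by omega) (by omega) q y hy]
      simp [hy]
    · by_cases hy : chainPosition (m + 1) (M + 1) y = 0
      · rw [hy, Sym2.eq_swap, mergeWeight_chainWeight_zero (by omega) (by omega) q x hx]
        simp [hx]
      · have h0 : 0 ∉ s(chainPosition (m + 1) (M + 1) x, chainPosition (m + 1) (M + 1) y) := by
          simp [Ne.symm hx, Ne.symm hy]
        rw [mergeWeight, if_neg h0, chainWeight]
        simp [hx, hy]
  · ring

theorem cycleOfCliques_connected (m n : ℕ) (hm : 3 ≤ m) (hn : 1 ≤ n) :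
    (cycleOfCliques m n).Connected := by
  have h0 : ∀ i : ℕ, ∀ hi : i < m, (cycleOfCliques m n).Reachable
      (⟨0, by omega⟩, ⟨0, hn⟩) (⟨i, hi⟩, ⟨0, hn⟩) := by
    intro i
    induction i with
    | zero => exact fun _ => SimpleGraph.Reachable.refl _
    | succ i ih =>
      intro hi
      refine (ih (by omega)).trans (SimpleGraph.Adj.reachable ⟨by simp, ⟨i, by omega⟩, ?_, ?_⟩)
      · exact Or.inl rfl
      · exact Or.inr ⟨(Nat.mod_eq_of_lt hi).symm, rfl⟩
  have h1 : ∀ x, (cycleOfCliques m n).Reachable (⟨0, by omega⟩, ⟨0, hn⟩) x := by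
    rintro ⟨⟨i, hi⟩, j⟩
    refine (h0 i hi).trans ?_
    by_cases hj : j = ⟨0, hn⟩
    · rw [hj]
    · refine SimpleGraph.Adj.reachable ⟨?_, ⟨i, hi⟩, Or.inl rfl, Or.inl rfl⟩
      intro h
      exact hj (Prod.ext_iff.1 h).2.symm
  exact { preconnected := fun x y => (h1 x).symm.trans (h1 y), nonempty := ⟨(⟨0, by omega⟩, ⟨0, hn⟩)⟩ }

end Cycle

/-! ### Location of the real roots. -/

section RealRoots

variable {V : Type*}

lemma reliability_pos [Fintype V] {G : SimpleGraph V} (hG : G.Connected) {x : ℝ}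
    (h0 : 0 ≤ x) (h1 : x < 1) : 0 < reliability G x := by
  classical
  have h1' : 0 < 1 - x := sub_pos.2 h1
  rw [reliability]
  refine Finset.sum_pos' (fun S _ => by positivity) ⟨G.edgeFinset, ?_, ?_⟩
  · simp [hG]
  · simp only [tsub_self, pow_zero, mul_one]
    positivity

lemma reliability_ofReal [Fintype V] (G : SimpleGraph V) (x : ℝ) :
    reliability G (x : ℂ) = (reliability G x : ℝ) := by
  simp [reliability]

variable [DecidableEq V]

/-- The product of the weights of all pairs of distinct vertices of `A`. -/
def pairProd (w : Sym2 V → ℝ) (A : Finset V) : ℝ :=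
  ∏ e ∈ A.sym2 with ¬ e.IsDiag, w e

lemma pairProd_singleton (w : Sym2 V → ℝ) (r : V) : pairProd w {r} = 1 := by
  refine Finset.prod_eq_one fun e he => ?_
  rw [Finset.mem_filter] at he
  induction e with
  | h x y =>
    simp only [Finset.mk_mem_sym2_iff, Finset.mem_singleton, Sym2.mk_isDiag_iff] at he
    exact absurd (he.1.1.trans he.1.2.symm) he.2

lemma pairProd_insert (w : Sym2 V → ℝ) {a : V} {A : Finset V} (ha : a ∉ A) :
    pairProd w (insert a A) = (∏ x ∈ A, w s(a, x)) * pairProd w A := by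
  have hset : ((insert a A).sym2.filter fun e => ¬ e.IsDiag) =
      A.image (fun x => s(a, x)) ∪ A.sym2.filter fun e => ¬ e.IsDiag := by
    ext e
    induction e with
    | h x y =>
      simp only [Finset.mem_filter, Finset.mk_mem_sym2_iff, Finset.mem_insert, Sym2.mk_isDiag_iff,
        Finset.mem_union, Finset.mem_image, Sym2.eq_iff]
      grind
  rw [pairProd, hset, Finset.prod_union, Finset.prod_image, pairProd]
  · intro x _ y _ h
    simp only [Sym2.eq_iff] at h
    grind
  · rw [Finset.disjoint_left]
    intro e he he'
    rw [Finset.mem_image] at he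
    obtain ⟨x, _, rfl⟩ := he
    simp [ha] at he'

lemma pairProd_update (w : Sym2 V → ℝ) {r u : V} {A : Finset V} (hr : r ∈ A) (hu : u ∈ A)
    (hru : r ≠ u) :
    pairProd w A = w s(r, u) * pairProd (Function.update w s(r, u) 1) A := by
  have hmem : s(r, u) ∈ A.sym2.filter fun e => ¬ e.IsDiag := by simp [hr, hu, hru]
  unfold pairProd
  rw [← Finset.mul_prod_erase _ _ hmem, ← Finset.mul_prod_erase _ _ hmem,
    Function.update_self, one_mul]
  congr 1
  refine Finset.prod_congr rfl fun e he => ?_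
  rw [Function.update_of_ne (Finset.ne_of_mem_erase he)]

/-- Merging multiplies the weights of `s(r, x)` and `s(u, x)`, so the pair `s(r, u)` is the only
factor lost. -/
lemma pairProd_mergeWeight (w : Sym2 V → ℝ) {r u : V} {A : Finset V} (hr : r ∈ A) (hu : u ∈ A)
    (hru : r ≠ u) :
    pairProd w A = w s(r, u) * pairProd (mergeWeight w r u) (A.erase u) := by
  have hr' : r ∈ A.erase u := by simp [hr, hru]
  have hu1 : u ∉ A.erase u := by simp
  have hr1 : r ∉ (A.erase u).erase r := by simp
  conv_lhs => rw [← Finset.insert_erase hu, pairProd_insert w hu1, ← Finset.insert_erase hr',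
    pairProd_insert w hr1, Finset.prod_insert hr1]
  conv_rhs => rw [← Finset.insert_erase hr', pairProd_insert _ hr1]
  have e1 : ∏ x ∈ (A.erase u).erase r, mergeWeight w r u s(r, x) =
      (∏ x ∈ (A.erase u).erase r, w s(r, x)) * ∏ x ∈ (A.erase u).erase r, w s(u, x) := by
    rw [← Finset.prod_mul_distrib]
    refine Finset.prod_congr rfl fun x hx => ?_
    simp [mergeWeight, Finset.ne_of_mem_erase hx]
  have e2 : pairProd (mergeWeight w r u) ((A.erase u).erase r) =
      pairProd w ((A.erase u).erase r) := by
    refine Finset.prod_congr rfl fun e he => ?_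
    rw [Finset.mem_filter] at he
    rw [mergeWeight, if_neg]
    intro h
    exact hr1 (Finset.mem_sym2_iff.1 he.1 r h)
  rw [e1, e2, Sym2.eq_swap (a := u)]
  ring

/-- If all weights are `1` or of absolute value larger than `1`, then the sign of the connection
weight is determined by the number of vertices and the signs of the weights. -/
lemma connWeight_sign {r : V} (n : ℕ) : ∀ (A : Finset V) (w : Sym2 V → ℝ), r ∈ A → A.card = n →
    (∀ x ∈ A, ∀ y ∈ A, x ≠ y → w s(x, y) = 1 ∨ 1 < |w s(x, y)|) →
    0 ≤ (-1) ^ (n + 1) * (connWeight w A * pairProd w A) ∧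
      ((∀ X ⊆ A, r ∈ X → X ≠ A → ∃ x ∈ X, ∃ y ∈ A \ X, w s(x, y) ≠ 1) →
        0 < (-1) ^ (n + 1) * (connWeight w A * pairProd w A)) := by
  induction n with
  | zero =>
    intro A w hr hc
    rw [Finset.card_eq_zero] at hc
    simp [hc] at hr
  | succ n ih =>
    intro A w hr hA
    generalize hk : ((A.erase r).filter fun u => w s(r, u) ≠ 1).card = k
    -- Inner induction on the number of pairs at the root with weight ≠ 1: deletion lowers this
    -- number, contraction lowers the number of vertices.
    induction k generalizing w with
    | zero =>
      intro _
      rw [Finset.card_eq_zero, Finset.filter_eq_empty_iff] at hk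
      rcases (A.erase r).eq_empty_or_nonempty with he | hne
      · have hA1 : A = {r} := by rw [← Finset.insert_erase hr, he, insert_empty_eq]
        have hn : n = 0 := by
          rw [hA1, Finset.card_singleton] at hA
          omega
        rw [hA1, connWeight_singleton, pairProd_singleton, hn]
        norm_num
      · have hz : connWeight w A = 0 := by
          have := connWeight_union_eq_zero (w := w) (P := {r}) (Q := A.erase r) ⟨r, by simp⟩ hne
            (by simp) ?_
          · rwa [← Finset.insert_eq, Finset.insert_erase hr] at this
          · intro x hx y hy
            rw [Finset.mem_singleton] at hx
            subst hx
            exact not_not.1 (hk hy)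
        refine ⟨by simp [hz], fun hcut => ?_⟩
        obtain ⟨x, hx, y, hy, hxy⟩ := hcut {r} (by simpa using hr) (by simp) (by
          rintro rfl
          simp at hne)
        rw [Finset.mem_singleton] at hx
        subst hx
        simp only [Finset.mem_sdiff, Finset.mem_singleton] at hy
        exact absurd hxy (hk (Finset.mem_erase.2 ⟨hy.2, hy.1⟩))
    | succ k ihk =>
      intro hw
      obtain ⟨u, hu⟩ : ((A.erase r).filter fun u => w s(r, u) ≠ 1).Nonempty := by
        rw [← Finset.card_pos]
        omega
      simp only [Finset.mem_filter, Finset.mem_erase] at hu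
      obtain ⟨⟨hur, huA⟩, hw1⟩ := hu
      have hru : r ≠ u := hur.symm
      have habs : 1 < |w s(r, u)| := (hw r hr u huA hru).resolve_left hw1
      set t := w s(r, u) with ht
      set w1 := Function.update w s(r, u) 1 with hw1_def
      have hne : ∀ x y, s(x, y) ≠ s(r, u) → w1 s(x, y) = w s(x, y) := fun x y h =>
        Function.update_of_ne h _ _
      have h1 := (ihk w1 ?_ ?_).1
      · have h2 := ih (A.erase u) (mergeWeight w r u) (by simp [hr, hru])
          (by rw [Finset.card_erase_of_mem huA, hA]; rfl) ?_
        · have key : (-1) ^ (n + 1 + 1) * (connWeight w A * pairProd w A) =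
              t ^ 2 * ((-1) ^ (n + 1 + 1) * (connWeight w1 A * pairProd w1 A)) +
              (t * (t - 1)) * ((-1) ^ (n + 1) * (connWeight (mergeWeight w r u) (A.erase u) *
                pairProd (mergeWeight w r u) (A.erase u))) := by
            have e1 := connWeight_deletion_contraction w hr huA hru
            have e2 := pairProd_update w hr huA hru
            have e3 := pairProd_mergeWeight w hr huA hru
            rw [← ht, ← hw1_def] at e1 e2
            rw [← ht] at e3
            rw [e1, add_mul, mul_add]
            congr 1
            · rw [e2]
              ring
            · rw [e3]
              ring
          have hpos : 0 < t * (t - 1) := by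
            rcases lt_abs.1 habs with h | h <;> nlinarith
          rw [key]
          -- Strictness is drawn from the contraction, which stays connected; the deletion need not.
          refine ⟨by have := h2.1; positivity, fun hcut => ?_⟩
          have h3 := h2.2 ?_
          · have : 0 < t * (t - 1) * ((-1) ^ (n + 1) *
              (connWeight (mergeWeight w r u) (A.erase u) *
                pairProd (mergeWeight w r u) (A.erase u))) := mul_pos hpos h3
            have : 0 ≤ t ^ 2 * ((-1) ^ (n + 1 + 1) * (connWeight w1 A * pairProd w1 A)) :=
              mul_nonneg (sq_nonneg t) h1
            linarith
          · intro X hX hrX hXA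
            have huX : u ∉ X := fun h => by simpa using hX h
            obtain ⟨x, hx, y, hy, hxy⟩ := hcut (insert u X)
              (Finset.insert_subset huA (hX.trans (Finset.erase_subset _ _))) (by simp [hrX])
              (by
                intro h
                apply hXA
                rw [← h, Finset.erase_insert huX])
            simp only [Finset.mem_sdiff, Finset.mem_insert, not_or] at hx hy
            have hyr : y ≠ r := by rintro rfl; exact hy.2.2 hrX
            have hyX : y ∈ (A.erase u) \ X := by
              simp only [Finset.mem_sdiff, Finset.mem_erase]
              exact ⟨⟨hy.2.1, hy.1⟩, hy.2.2⟩
            by_cases hxr : x ≠ r ∧ x ≠ u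
            · refine ⟨x, hx.resolve_left hxr.2, y, hyX, ?_⟩
              rwa [mergeWeight, if_neg (by simp [hxr.1.symm, hyr.symm])]
            · refine ⟨r, hrX, y, hyX, ?_⟩
              have e : mergeWeight w r u s(r, y) = w s(r, y) * w s(u, y) := by
                simp [mergeWeight, hyr]
              rw [e]
              -- A product of two weights, each 1 or of modulus > 1, equals 1 only if both are 1, so
              -- parallel edges created by merging cannot cancel.
              intro hprod
              have hprod' := congrArg abs hprod
              rw [abs_mul, abs_one] at hprod'
              have hr1 := hw r hr y hy.1 hyr.symm
              have hu1 := hw u huA y hy.1 (Ne.symm hy.2.1)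
              have hx' : x = r ∨ x = u := by tauto
              rcases hr1 with hr1 | hr1 <;> rcases hu1 with hu1 | hu1
              · rcases hx' with rfl | rfl <;> contradiction
              · rw [hr1, abs_one, one_mul] at hprod'
                linarith
              · rw [hu1, abs_one, mul_one] at hprod'
                linarith
              · nlinarith
        · intro x hx y hy hxy
          rw [Finset.mem_erase] at hx hy
          have hprod : ∀ y ∈ A, y ≠ r → y ≠ u → mergeWeight w r u s(r, y) = 1 ∨
              1 < |mergeWeight w r u s(r, y)| := by
            intro y hy hyr hyu
            have e : mergeWeight w r u s(r, y) = w s(r, y) * w s(u, y) := by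
              simp [mergeWeight, hyr]
            rw [e, abs_mul]
            rcases hw r hr y hy hyr.symm with h | h <;>
              rcases hw u huA y hy hyu.symm with h' | h'
            · simp [h, h']
            · simp [h, h']
            · simp [h, h']
            · exact Or.inr (by nlinarith)
          by_cases hxr : x = r
          · subst hxr
            exact hprod y hy.2 hxy.symm hy.1
          · by_cases hyr : y = r
            · subst hyr
              rw [Sym2.eq_swap]
              exact hprod x hx.2 hxr hx.1
            · rw [mergeWeight, if_neg (by simp [Ne.symm hxr, Ne.symm hyr])]
              exact hw x hx.2 y hy.2 hxy
      · have hset : (A.erase r).filter (fun v => w1 s(r, v) ≠ 1) =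
            ((A.erase r).filter fun v => w s(r, v) ≠ 1).erase u := by
          ext v
          simp only [Finset.mem_filter, Finset.mem_erase]
          by_cases hv : v = u
          · subst hv
            simp [hw1_def]
          · rw [hne r v (by simp only [ne_eq, Sym2.eq_iff]; grind)]
            tauto
        rw [hset, Finset.card_erase_of_mem (by simp only [Finset.mem_filter, Finset.mem_erase]; exact ⟨⟨hur, huA⟩, hw1⟩), hk]
        rfl
      · intro x hx y hy hxy
        by_cases h : s(x, y) = s(r, u)
        · left
          rw [h, hw1_def, Function.update_self]
        · rw [hne x y h]
          exact hw x hx y hy hxy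

lemma reliability_ne_zero_of_one_lt_abs [Fintype V] {G : SimpleGraph V} (hG : G.Connected) {x : ℝ}
    (hx : 1 < |x|) : reliability G x ≠ 0 := by
  classical
  have := hG.nonempty
  obtain ⟨r⟩ := hG.nonempty
  rw [reliability_eq_connWeight]
  have h := (connWeight_sign (r := r) _ Finset.univ (fun e => if e ∈ G.edgeSet then x else 1)
    (Finset.mem_univ r) rfl ?_).2 ?_
  · intro h0
    rw [h0] at h
    simp at h
  · intro a _ b _ _
    split_ifs
    · exact Or.inr hx
    · exact Or.inl rfl
  · intro X _ hr hX
    obtain ⟨t, ht⟩ : ∃ t, t ∉ X := by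
      by_contra! hc
      exact hX (Finset.eq_univ_iff_forall.2 hc)
    obtain ⟨a, ha, b, hb, hab⟩ := exists_adj_of_connected hG hr ht
    refine ⟨a, ha, b, by simpa using hb, ?_⟩
    rw [if_pos (by simpa using hab)]
    rintro rfl
    simp at hx

/-- The real reliability roots of connected graphs lie in `[-1, 0] ∪ {1}`. -/
theorem mem_of_ofReal_mem_simpleReliabilityRoots {x : ℝ}
    (hx : (x : ℂ) ∈ simpleReliabilityRoots) : x ∈ Set.Icc (-1 : ℝ) 0 ∪ {1} := by
  classical
  obtain ⟨V, _, G, hG, h⟩ := hx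
  rw [reliability_ofReal, Complex.ofReal_eq_zero] at h
  have h1 : |x| ≤ 1 := by
    by_contra! hc
    exact reliability_ne_zero_of_one_lt_abs hG hc h
  rw [abs_le] at h1
  by_cases h0 : x ≤ 0
  · exact Or.inl ⟨h1.1, h0⟩
  · right
    by_contra hne
    exact (reliability_pos hG (not_le.1 h0).le (lt_of_le_of_ne h1.2 hne)).ne' h

end RealRoots

/-! ### Uniform asymptotics of the clique polynomials in the open disk. -/

section Asymptotics

open Filter Topology

/-- The sum of `C(N, k) * ρ ^ (k * (N - k))` over `0 < k < N`, for `N = M + 1`. -/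
noncomputable def midSum (ρ : ℝ) (M : ℕ) : ℝ :=
  ∑ j ∈ Finset.range M, ((M + 1).choose (j + 1) : ℝ) * ρ ^ ((j + 1) * (M - j))

lemma midSum_nonneg {ρ : ℝ} (h : 0 ≤ ρ) (M : ℕ) : 0 ≤ midSum ρ M :=
  Finset.sum_nonneg fun _ _ => by positivity

/-- With N = M + 1 and y = s^N, the bound 2k(N - k) ≥ N · min(k, N - k) dominates each term by y^k
or y^(N - k). Both binomial sums are at most (1 + y)^N - 1 ≤ e^(Ny) - 1, and N s^N → 0 if s < 1. -/
lemma midSum_sq_le {s : ℝ} (h0 : 0 ≤ s) (h1 : s ≤ 1) (M : ℕ) :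
    midSum (s ^ 2) M ≤ 2 * (Real.exp ((M + 1 : ℕ) * s ^ (M + 1)) - 1) := by
  set y := s ^ (M + 1) with hy
  have hy0 : 0 ≤ y := by positivity
  have hpow : (y + 1) ^ (M + 1) ≤ Real.exp ((M + 1 : ℕ) * y) := by
    rw [Real.exp_nat_mul]
    gcongr
    exact Real.add_one_le_exp y
  have hc : ∀ a b, y ^ a * ((M + 1).choose b : ℝ) = (M + 1).choose b * y ^ a :=
    fun _ _ => mul_comm _ _
  have e1 : ∑ j ∈ Finset.range M, ((M + 1).choose (j + 1) : ℝ) * y ^ (j + 1) ≤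
      (y + 1) ^ (M + 1) - 1 := by
    rw [add_pow, Finset.sum_range_succ', Finset.sum_range_succ]
    simp only [one_pow, mul_one, pow_zero, Nat.choose_zero_right, Nat.cast_one, hc]
    have : 0 ≤ ((M + 1).choose (M + 1) : ℝ) * y ^ (M + 1) := by positivity
    linarith
  have e2 : ∑ j ∈ Finset.range M, ((M + 1).choose (j + 1) : ℝ) * y ^ (M - j) ≤
      (y + 1) ^ (M + 1) - 1 := by
    rw [add_comm y, add_pow, Finset.sum_range_succ, Finset.sum_range_succ']
    simp only [one_pow, one_mul, Nat.sub_self, pow_zero, Nat.choose_self, Nat.cast_one,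
      Nat.add_sub_add_right, hc]
    have : 0 ≤ ((M + 1).choose 0 : ℝ) * y ^ (M + 1 - 0) := by positivity
    linarith
  have e3 : midSum (s ^ 2) M ≤ ∑ j ∈ Finset.range M, ((M + 1).choose (j + 1) : ℝ) * y ^ (j + 1) +
      ∑ j ∈ Finset.range M, ((M + 1).choose (j + 1) : ℝ) * y ^ (M - j) := by
    rw [← Finset.sum_add_distrib]
    refine Finset.sum_le_sum fun j hj => ?_
    rw [Finset.mem_range] at hj
    rw [← mul_add]
    refine mul_le_mul_of_nonneg_left ?_ (Nat.cast_nonneg _)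
    rw [hy, ← pow_mul, ← pow_mul, ← pow_mul]
    obtain ⟨k, rfl⟩ : ∃ k, M = j + k := ⟨M - j, by omega⟩
    rw [Nat.add_sub_cancel_left]
    have p1 : 0 ≤ s ^ ((j + k + 1) * (j + 1)) := by positivity
    have p2 : 0 ≤ s ^ ((j + k + 1) * k) := by positivity
    rcases le_total (j + 1) k with h | h
    · have : s ^ (2 * ((j + 1) * k)) ≤ s ^ ((j + k + 1) * (j + 1)) :=
        pow_le_pow_of_le_one h0 h1 (by nlinarith)
      linarith
    · have : s ^ (2 * ((j + 1) * k)) ≤ s ^ ((j + k + 1) * k) :=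
        pow_le_pow_of_le_one h0 h1 (by nlinarith)
      linarith
  linarith

lemma tendsto_midSum {ρ : ℝ} (h0 : 0 ≤ ρ) (h1 : ρ < 1) : Tendsto (midSum ρ) atTop (𝓝 0) := by
  have hs0 : 0 ≤ √ρ := Real.sqrt_nonneg ρ
  have hs1 : √ρ < 1 := by rw [Real.sqrt_lt' one_pos]; simpa using h1
  have hlim : Tendsto (fun M : ℕ => 2 * (Real.exp ((M + 1 : ℕ) * √ρ ^ (M + 1)) - 1)) atTop
      (𝓝 0) := by
    have h := ((tendsto_self_mul_const_pow_of_lt_one hs0 hs1).comp (tendsto_add_atTop_nat 1))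
    have h2 := (((Real.continuous_exp.tendsto 0).comp h).sub_const 1).const_mul 2
    simpa using h2
  refine squeeze_zero (midSum_nonneg h0) (fun M => ?_) hlim
  have := midSum_sq_le hs0 hs1.le M
  rwa [Real.sq_sqrt h0] at this

variable {𝕜 : Type*} [RCLike 𝕜]

/-- Only smaller cliques need the bound `B`, so the estimate can be bootstrapped. -/
lemma norm_cliqueRel_sub_one_le {ρ B : ℝ} {q : 𝕜} (hq : ‖q‖ ≤ ρ) (M : ℕ)
    (hB : ∀ k < M + 1, ‖cliqueRel q k‖ ≤ B) :
    ‖cliqueRel q (M + 1) - 1‖ ≤ B * midSum ρ M := by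
  rw [cliqueRel_succ, sub_sub_cancel_left, norm_neg, midSum, Finset.mul_sum]
  refine (norm_sum_le _ _).trans (Finset.sum_le_sum fun j hj => ?_)
  rw [Finset.mem_range] at hj
  have hρ : 0 ≤ ρ := (norm_nonneg q).trans hq
  have hB0 : 0 ≤ B := (norm_nonneg _).trans (hB 0 (by omega))
  have hch : ((M.choose j : ℕ) : ℝ) ≤ ((M + 1).choose (j + 1) : ℕ) := by
    rw [Nat.choose_succ_succ]
    exact_mod_cast Nat.le_add_right _ _
  rw [norm_mul, norm_mul, norm_pow, RCLike.norm_natCast]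
  calc (M.choose j : ℝ) * ‖cliqueRel q (j + 1)‖ * ‖q‖ ^ ((j + 1) * (M - j))
      ≤ ((M + 1).choose (j + 1) : ℝ) * B * ρ ^ ((j + 1) * (M - j)) := by
        gcongr
        exact hB _ (by omega)
    _ = _ := by ring

lemma cliqueRel_one {R : Type*} [CommRing R] (q : R) : cliqueRel q 1 = 1 := by
  rw [cliqueRel_succ]
  simp

lemma norm_cliqueSplit_sub_two_le {ρ B : ℝ} {q : 𝕜} (hq : ‖q‖ ≤ ρ) (M : ℕ)
    (hB : ∀ k, ‖cliqueRel q k‖ ≤ B) :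
    ‖cliqueSplit q (M + 1) - 2‖ ≤ B ^ 2 * midSum ρ M + 2 * ‖cliqueRel q (M + 2) - 1‖ := by
  have hρ : 0 ≤ ρ := (norm_nonneg q).trans hq
  have hB0 : 0 ≤ B := (norm_nonneg _).trans (hB 0)
  -- The 2 comes from the two extreme terms, where one terminal is isolated and the rest forms a
  -- clique on M + 2 vertices.
  have e : cliqueSplit q (M + 1) - 2 =
      ∑ j ∈ Finset.range M, ((M + 1).choose (j + 1) : 𝕜) *
        (cliqueRel q (j + 2) * cliqueRel q (M + 1 - j)) * q ^ ((j + 1) * (M - j)) +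
      2 * (cliqueRel q (M + 2) - 1) := by
    rw [cliqueSplit, Finset.sum_range_succ, Finset.sum_range_succ']
    simp only [Nat.choose_zero_right, Nat.cast_one, zero_mul, pow_zero, Nat.choose_self,
      Nat.sub_self, mul_zero, Nat.sub_zero, Nat.add_sub_add_right, Nat.add_sub_cancel_left,
      zero_add, cliqueRel_one]
    ring
  rw [e]
  refine (norm_add_le _ _).trans (add_le_add ?_ ?_)
  · rw [midSum, Finset.mul_sum]
    refine (norm_sum_le _ _).trans (Finset.sum_le_sum fun j _ => ?_)
    rw [norm_mul, norm_mul, norm_mul, norm_pow, RCLike.norm_natCast]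
    calc ((M + 1).choose (j + 1) : ℝ) * (‖cliqueRel q (j + 2)‖ * ‖cliqueRel q (M + 1 - j)‖) *
          ‖q‖ ^ ((j + 1) * (M - j))
        ≤ ((M + 1).choose (j + 1) : ℝ) * (B * B) * ρ ^ ((j + 1) * (M - j)) := by
          gcongr <;> exact hB _
      _ = _ := by ring
  · rw [norm_mul]
    simp

variable (𝕜) in
lemma exists_cliqueRel_bound {ρ : ℝ} (h0 : 0 ≤ ρ) (h1 : ρ < 1) :
    ∃ B : ℝ, ∀ q : 𝕜, ‖q‖ ≤ ρ → ∀ k, ‖cliqueRel q k‖ ≤ B := by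
  have hev : ∀ᶠ M in atTop, midSum ρ M ≤ 1 / 2 :=
    (tendsto_midSum h0 h1).eventually_le_const (by norm_num)
  obtain ⟨N, hN⟩ := eventually_atTop.1 hev
  have hfin : ∀ n : ℕ, ∃ B : ℝ, ∀ q : 𝕜, ‖q‖ ≤ ρ → ∀ k < n + 1, ‖cliqueRel q k‖ ≤ B := by
    intro n
    induction n with
    | zero =>
      refine ⟨1, fun q _ k hk => ?_⟩
      obtain rfl : k = 0 := by omega
      simp [cliqueRel]
    | succ n ih =>
      obtain ⟨B, hB⟩ := ih
      refine ⟨max B (1 + B * midSum ρ n), fun q hq k hk => ?_⟩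
      rcases Nat.lt_succ_iff_lt_or_eq.1 hk with h | rfl
      · exact (hB q hq k h).trans (le_max_left _ _)
      · refine le_trans ?_ (le_max_right _ _)
        have h2 := norm_cliqueRel_sub_one_le hq n (hB q hq)
        have h3 := norm_le_norm_add_norm_sub' (cliqueRel q (n + 1)) 1
        rw [norm_one] at h3
        linarith
  obtain ⟨B, hB⟩ := hfin N
  -- Once `midSum` is at most 1/2, a bound b ≥ 2 reproduces itself, since 1 + b/2 ≤ b.
  refine ⟨max B 2, fun q hq k => ?_⟩
  induction k using Nat.strong_induction_on with
  | _ k ih =>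
    rcases lt_or_ge k (N + 1) with h | h
    · exact (hB q hq k h).trans (le_max_left _ _)
    · obtain ⟨n, rfl⟩ : ∃ n, k = n + 1 := ⟨k - 1, by omega⟩
      have h2 := norm_cliqueRel_sub_one_le hq n ih
      have h3 := norm_le_norm_add_norm_sub' (cliqueRel q (n + 1)) 1
      rw [norm_one] at h3
      have h4 := hN n (by omega)
      have h5 : (2 : ℝ) ≤ max B 2 := le_max_right _ _
      nlinarith

variable (𝕜) in
lemma eventually_clique_bounds {ρ ε : ℝ} (h0 : 0 ≤ ρ) (h1 : ρ < 1) (hε : 0 < ε) :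
    ∀ᶠ M in atTop, ∀ q : 𝕜, ‖q‖ ≤ ρ →
      ‖cliqueRel q (M + 2) - 1‖ ≤ ε ∧ ‖cliqueSplit q M - 2‖ ≤ ε := by
  obtain ⟨B, hB⟩ := exists_cliqueRel_bound 𝕜 h0 h1
  have hT := tendsto_midSum h0 h1
  have hT1 := (tendsto_add_atTop_iff_nat 1).2 hT
  have l1 : Tendsto (fun M => B * midSum ρ (M + 1)) atTop (𝓝 0) := by
    simpa using hT1.const_mul B
  have l2 : Tendsto (fun M => B ^ 2 * midSum ρ M + 2 * (B * midSum ρ (M + 1))) atTop (𝓝 0) := by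
    simpa using (hT.const_mul (B ^ 2)).add (l1.const_mul 2)
  have ev1 : ∀ᶠ M in atTop, ∀ q : 𝕜, ‖q‖ ≤ ρ → ‖cliqueRel q (M + 2) - 1‖ ≤ ε := by
    filter_upwards [l1.eventually_le_const hε] with M hM q hq
    exact (norm_cliqueRel_sub_one_le hq (M + 1) fun k _ => hB q hq k).trans hM
  have ev2 : ∀ᶠ M in atTop, ∀ q : 𝕜, ‖q‖ ≤ ρ → ‖cliqueSplit q (M + 1) - 2‖ ≤ ε := by
    filter_upwards [l2.eventually_le_const hε] with M hM q hq
    have e1 := norm_cliqueRel_sub_one_le hq (M + 1) fun k _ => hB q hq k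
    have e2 := norm_cliqueSplit_sub_two_le hq M (hB q hq)
    linarith
  have ev2' : ∀ᶠ M in atTop, ∀ q : 𝕜, ‖q‖ ≤ ρ → ‖cliqueSplit q M - 2‖ ≤ ε := by
    obtain ⟨N, hN⟩ := eventually_atTop.1 ev2
    refine eventually_atTop.2 ⟨N + 1, fun M hM => ?_⟩
    obtain ⟨n, rfl⟩ : ∃ n, M = n + 1 := ⟨M - 1, by omega⟩
    exact hN n (by omega)
  filter_upwards [ev1, ev2'] with M a b q hq
  exact ⟨a q hq, b q hq⟩

variable (𝕜) in
lemma differentiable_cliqueRel (N : ℕ) : Differentiable 𝕜 fun q : 𝕜 => cliqueRel q N := by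
  induction N using Nat.strong_induction_on with
  | _ N ih =>
    rcases N with _ | N
    · simp [cliqueRel]
    · have : (fun q : 𝕜 => cliqueRel q (N + 1)) = fun q : 𝕜 => 1 - ∑ j ∈ Finset.range N,
          (N.choose j : 𝕜) * cliqueRel q (j + 1) * q ^ ((j + 1) * (N - j)) :=
        funext fun q => cliqueRel_succ q N
      rw [this]
      refine (differentiable_const _).sub (Differentiable.fun_sum fun j hj => ?_)
      rw [Finset.mem_range] at hj
      exact ((differentiable_const _).mul (ih (j + 1) (by omega))).mul (differentiable_id.pow _)

variable (𝕜) in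
lemma differentiable_cliqueSplit (M : ℕ) : Differentiable 𝕜 fun q : 𝕜 => cliqueSplit q M := by
  unfold cliqueSplit
  refine Differentiable.fun_sum fun j _ => ?_
  exact ((differentiable_const _).mul
    ((differentiable_cliqueRel 𝕜 _).mul (differentiable_cliqueRel 𝕜 _))).mul (differentiable_id.pow _)

end Asymptotics

/-! ### Density of the roots. -/

section Density

open Filter Topology

lemma mem_cycleOfCliquesRoots {m M : ℕ} (hm : 3 ≤ m) {q : ℂ}
    (h : cliqueRel q (M + 2) + m * (q ^ (M + 1) * cliqueSplit q M) = 0) :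
    q ∈ cycleOfCliquesRoots := by
  obtain ⟨k, rfl⟩ : ∃ k, m = k + 1 := ⟨m - 1, by omega⟩
  refine ⟨k + 1, M + 1, hm, by omega, ?_⟩
  push_cast at h
  rw [reliability_cycleOfCliques k M (by omega), h, mul_zero]

/-- An entire function close to `1 - exp` near `0` has a zero near `0`. -/
lemma exists_zero_of_near {f : ℂ → ℂ} (hf : Differentiable ℂ f)
    (h : ∀ t : ℂ, ‖t‖ ≤ 1 / 2 → ‖f t - (1 - Complex.exp t)‖ ≤ 1 / 25) :
    ∃ t : ℂ, ‖t‖ ≤ 1 / 2 ∧ f t = 0 := by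
  have h0 : ‖f 0‖ ≤ 1 / 25 := by simpa using h 0 (by norm_num)
  have hs : ∀ t ∈ Metric.sphere (0 : ℂ) (1 / 2), (1 / 10 : ℝ) ≤ ‖f t - f 0‖ := by
    intro t ht
    rw [mem_sphere_zero_iff_norm] at ht
    have h1 := h t ht.le
    have h2 := Complex.norm_exp_sub_one_sub_id_le (x := t) (by rw [ht]; norm_num)
    rw [ht] at h2
    have h3 : ‖t‖ ≤ ‖f t - f 0‖ + ‖f t - (1 - Complex.exp t)‖ + ‖f 0‖ +
        ‖Complex.exp t - 1 - t‖ := by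
      have : t = -(f t - f 0) + (f t - (1 - Complex.exp t)) - f 0 - (Complex.exp t - 1 - t) := by
        ring
      nth_rw 1 [this]
      refine (norm_sub_le _ _).trans (add_le_add ((norm_sub_le _ _).trans
        (add_le_add ((norm_add_le _ _).trans ?_) le_rfl)) le_rfl)
      rw [norm_neg]
    rw [ht] at h3
    norm_num at h2
    linarith
  have hfreq : ∃ᶠ z in 𝓝 (0 : ℂ), f z ≠ f 0 := by
    intro hev
    have hev' : f =ᶠ[𝓝 0] fun _ => f 0 := by
      filter_upwards [hev] with z hz
      exact not_not.1 hz
    have heq := AnalyticOnNhd.eq_of_eventuallyEq (fun z _ => hf.analyticAt z)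
      (fun z _ => analyticAt_const) hev'
    have := hs (1 / 2) (by simp)
    rw [congrFun heq (1 / 2)] at this
    norm_num at this
  -- The image contains the disk of radius half of 1/10 about `f 0`, and it contains 0 because ‖f 0‖
  -- ≤ 1/25 < 1/20.
  have := (hf.diffContOnCl (s := Metric.ball 0 (1 / 2))).ball_subset_image_closedBall
    (by norm_num) hs hfreq
  obtain ⟨t, ht, hft⟩ := this (a := 0) (by
    rw [Metric.mem_ball, dist_comm, dist_zero_right]
    linarith)
  exact ⟨t, by simpa using ht, hft⟩

lemma exists_cycleOfCliquesRoot_near {q₀ : ℂ} (h0 : q₀ ≠ 0) (h1 : ‖q₀‖ < 1) {ε : ℝ} (hε : 0 < ε) :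
    ∃ q ∈ cycleOfCliquesRoots, dist q q₀ < ε := by
  have hpos : 0 < ‖q₀‖ := norm_pos_iff.2 h0
  set ρ := (1 + ‖q₀‖) / 2 with hρ
  set L := -Real.log ‖q₀‖ with hL
  have hLpos : 0 < L := by
    rw [hL, neg_pos]
    exact Real.log_neg hpos h1
  set θ := q₀.arg with hθ
  have hexp : Complex.exp (Complex.log q₀) = q₀ := Complex.exp_log h0
  have hlog : Complex.log q₀ = -L + θ * Complex.I := by
    rw [Complex.log, hL]
    push_cast
    ring
  obtain ⟨η, hη, hηe⟩ := Metric.continuous_iff.1 Complex.continuous_exp (Complex.log q₀)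
    (min ε (ρ - ‖q₀‖)) (lt_min hε (by rw [hρ]; linarith))
  rw [hexp] at hηe
  have ev1 := eventually_clique_bounds ℂ (ρ := ρ) (ε := 1 / 100) (by positivity)
    (by rw [hρ]; linarith) (by norm_num)
  have hn : Tendsto (fun M : ℕ => ((M + 1 : ℕ) : ℝ)) atTop atTop :=
    tendsto_natCast_atTop_atTop.comp (tendsto_add_atTop_nat 1)
  have ev2 : ∀ᶠ M : ℕ in atTop, 3 ≤ Real.exp ((M + 1 : ℕ) * L) :=
    (Real.tendsto_exp_atTop.comp (hn.atTop_mul_const hLpos)).eventually_ge_atTop 3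
  -- Bounds n(W t - log q₀): log 4 for the modulus, π for the argument, 1 for t.
  set C := Real.log 4 + Real.pi + 1 with hC
  have ev3 : ∀ᶠ M : ℕ in atTop, C / η < (M + 1 : ℕ) := hn.eventually_gt_atTop _
  obtain ⟨M, hM1, hM2, hM3⟩ := (ev1.and (ev2.and ev3)).exists
  set n := M + 1 with hn_def
  have hn0 : (0 : ℝ) < (n : ℕ) := by positivity
  have hnC : ((n : ℕ) : ℂ) ≠ 0 := by exact_mod_cast hn0.ne'
  -- Since e^(nL) = |q₀|^(-n), this gives e^(nL) ≤ 2m ≤ 4 e^(nL).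
  set m := ⌈Real.exp (n * L)⌉₊ with hm
  have hm_ge : Real.exp (n * L) ≤ m := Nat.le_ceil _
  have hm_lt : (m : ℝ) < Real.exp (n * L) + 1 := Nat.ceil_lt_add_one (Real.exp_pos _).le
  have hm3 : 3 ≤ m := by
    have : (3 : ℝ) ≤ m := hM2.trans hm_ge
    exact_mod_cast this
  have hm0 : (0 : ℝ) < m := by positivity
  have hlog1 : |n * L - Real.log (2 * m)| ≤ Real.log 4 := by
    have a1 : Real.log (Real.exp (n * L)) ≤ Real.log (2 * m) :=
      Real.log_le_log (Real.exp_pos _) (by linarith)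
    have a2 : Real.log (2 * m) ≤ Real.log (4 * Real.exp (n * L)) :=
      Real.log_le_log (by positivity) (by linarith)
    rw [Real.log_mul (by norm_num) (Real.exp_pos _).ne', Real.log_exp] at a2
    rw [Real.log_exp] at a1
    have : 0 ≤ Real.log 4 := Real.log_nonneg (by norm_num)
    rw [abs_le]
    constructor <;> linarith
  set k := ⌊n * θ / (2 * Real.pi)⌋ with hk
  have hpi := Real.pi_pos
  have harg : |Real.pi * (2 * k + 1) - n * θ| ≤ Real.pi := by
    have b1 : (k : ℝ) * (2 * Real.pi) ≤ n * θ := by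
      rw [← le_div_iff₀ (by positivity)]
      exact Int.floor_le _
    have b2 : n * θ < ((k : ℝ) + 1) * (2 * Real.pi) := by
      rw [← div_lt_iff₀ (by positivity)]
      exact Int.lt_floor_add_one _
    rw [abs_le]
    constructor <;> linarith
  -- At t = 0 this is the logarithm of a root of 1 + 2 m q^n; the integer k selects the one whose
  -- argument is closest to that of q₀ up to O(1/n).
  let W : ℂ → ℂ := fun t =>
    (((-Real.log (2 * m) : ℝ) : ℂ) + ((Real.pi * (2 * k + 1) : ℝ) : ℂ) * Complex.I + t) / n
  have hW : ∀ t : ℂ, ‖t‖ ≤ 1 / 2 → dist (W t) (Complex.log q₀) < η := by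
    intro t ht
    have e : W t - Complex.log q₀ = (((n * L - Real.log (2 * m) : ℝ) : ℂ) +
        ((Real.pi * (2 * k + 1) - n * θ : ℝ) : ℂ) * Complex.I + t) / n := by
      simp only [W]
      rw [hlog]
      field_simp
      push_cast
      ring
    rw [dist_eq_norm, e, norm_div, Complex.norm_natCast, div_lt_iff₀ hn0]
    have e2 : ‖((n * L - Real.log (2 * m) : ℝ) : ℂ) +
        ((Real.pi * (2 * k + 1) - n * θ : ℝ) : ℂ) * Complex.I + t‖ ≤ C := by
      refine (norm_add_le _ _).trans ?_
      refine (add_le_add (norm_add_le _ _) le_rfl).trans ?_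
      rw [norm_mul, Complex.norm_I, mul_one, Complex.norm_real, Complex.norm_real,
        Real.norm_eq_abs, Real.norm_eq_abs]
      rw [hC]
      linarith
    rw [div_lt_iff₀ hη] at hM3
    linarith
  have hWpow : ∀ t : ℂ, (m : ℂ) * Complex.exp (W t) ^ n = -(Complex.exp t / 2) := by
    intro t
    have hmC : (m : ℂ) ≠ 0 := by exact_mod_cast hm0.ne'
    have e1 : Complex.exp ((-Real.log (2 * m) : ℝ) : ℂ) = (2 * (m : ℂ))⁻¹ := by
      rw [← Complex.ofReal_exp, Real.exp_neg, Real.exp_log (by positivity)]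
      push_cast
      rfl
    have e2 : Complex.exp (((Real.pi * (2 * k + 1) : ℝ) : ℂ) * Complex.I) = -1 := by
      have : ((Real.pi * (2 * k + 1) : ℝ) : ℂ) * Complex.I =
          Real.pi * Complex.I + k * (2 * Real.pi * Complex.I) := by
        push_cast
        ring
      rw [this, Complex.exp_add, Complex.exp_pi_mul_I, Complex.exp_int_mul_two_pi_mul_I, mul_one]
    rw [← Complex.exp_nat_mul, mul_div_cancel₀ _ hnC, Complex.exp_add, Complex.exp_add, e1, e2]
    field_simp
  let f : ℂ → ℂ := fun t => cliqueRel (Complex.exp (W t)) (M + 2) +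
    m * (Complex.exp (W t) ^ n * cliqueSplit (Complex.exp (W t)) M)
  have hWd : Differentiable ℂ fun t => Complex.exp (W t) := by
    simp only [W]
    fun_prop
  have hfd : Differentiable ℂ f :=
    ((differentiable_cliqueRel ℂ (M + 2)).comp hWd).add
      ((differentiable_const _).mul ((hWd.pow n).mul ((differentiable_cliqueSplit ℂ M).comp hWd)))
  have hnear : ∀ t : ℂ, ‖t‖ ≤ 1 / 2 → ‖f t - (1 - Complex.exp t)‖ ≤ 1 / 25 := by
    intro t ht
    have hd := (hηe _ (hW t ht)).trans_le (min_le_right _ _)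
    have hqn : ‖Complex.exp (W t)‖ ≤ ρ := by
      have := norm_le_norm_add_norm_sub' (Complex.exp (W t)) q₀
      rw [dist_eq_norm] at hd
      linarith
    obtain ⟨b1, b2⟩ := hM1 _ hqn
    have e : f t - (1 - Complex.exp t) = (cliqueRel (Complex.exp (W t)) (M + 2) - 1) -
        Complex.exp t / 2 * (cliqueSplit (Complex.exp (W t)) M - 2) := by
      simp only [f]
      rw [← mul_assoc, hWpow]
      ring
    have hexpt : ‖Complex.exp t‖ ≤ 2 := by
      have c1 := Complex.norm_exp_sub_one_sub_id_le (x := t) (by linarith)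
      have c2 : ‖Complex.exp t‖ ≤ ‖Complex.exp t - 1 - t‖ + ‖(1 : ℂ)‖ + ‖t‖ := by
        have : Complex.exp t = (Complex.exp t - 1 - t) + 1 + t := by ring
        nth_rw 1 [this]
        exact (norm_add_le _ _).trans (add_le_add (norm_add_le _ _) le_rfl)
      rw [norm_one] at c2
      nlinarith [norm_nonneg t]
    rw [e]
    refine (norm_sub_le _ _).trans ?_
    rw [norm_mul, norm_div, Complex.norm_ofNat]
    nlinarith [norm_nonneg (Complex.exp t), norm_nonneg (cliqueSplit (Complex.exp (W t)) M - 2)]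
  obtain ⟨t, ht, hft⟩ := exists_zero_of_near hfd hnear
  exact ⟨Complex.exp (W t), mem_cycleOfCliquesRoots hm3 hft,
    (hηe _ (hW t ht)).trans_le (min_le_left _ _)⟩

theorem closedBall_subset_closure_cycleOfCliquesRoots :
    Metric.closedBall (0 : ℂ) 1 ⊆ closure cycleOfCliquesRoots := by
  rw [← closure_ball (0 : ℂ) one_ne_zero]
  refine closure_minimal ?_ isClosed_closure
  -- The centre is discarded because the approximation uses log q₀.
  refine ((dense_compl_singleton (0 : ℂ)).open_subset_closure_inter Metric.isOpen_ball).trans ?_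
  refine closure_minimal ?_ isClosed_closure
  rintro q ⟨hq, hq0⟩
  rw [mem_ball_zero_iff] at hq
  rw [Metric.mem_closure_iff]
  intro ε hε
  obtain ⟨z, hz, hd⟩ := exists_cycleOfCliquesRoot_near hq0 hq hε
  exact ⟨z, hz, by rwa [dist_comm]⟩

lemma ofReal_cliqueRel (x : ℝ) (N : ℕ) : cliqueRel (x : ℂ) N = (cliqueRel x N : ℝ) := by
  induction N using Nat.strong_induction_on with
  | _ N ih =>
    rcases N with _ | N
    · simp [cliqueRel]
    · rw [cliqueRel_succ, cliqueRel_succ]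
      push_cast
      congr 1
      refine Finset.sum_congr rfl fun j hj => ?_
      rw [Finset.mem_range] at hj
      rw [ih (j + 1) (by omega)]

lemma ofReal_cliqueSplit (x : ℝ) (M : ℕ) : cliqueSplit (x : ℂ) M = (cliqueSplit x M : ℝ) := by
  simp [cliqueSplit, ofReal_cliqueRel]

/-- For odd n and x < 0 the second factor is R - m|x|^n S, with R ≈ 1 and S ≈ 2. Taking m =
⌈|a|^(-n)⌉ makes m|a|^n ≥ 1, whereas m|b|^n ≤ (b/a)^n + |b|^n is small for large n; hence a sign
change on [a, b]. -/
lemma exists_real_cycleOfCliquesRoot_mem_Icc {a b : ℝ} (ha : -1 < a) (hab : a < b) (hb : b < 0) :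
    ∃ x ∈ Set.Icc a b, (x : ℂ) ∈ cycleOfCliquesRoots := by
  have ha0 : 0 < -a := by linarith
  have hb0 : 0 < -b := by linarith
  have hodd : Tendsto (fun p : ℕ => 2 * p) atTop atTop :=
    tendsto_id.const_mul_atTop' (by norm_num)
  have hodd1 : Tendsto (fun p : ℕ => 2 * p + 1) atTop atTop :=
    (tendsto_add_atTop_nat 1).comp hodd
  have ev1 := hodd.eventually (eventually_clique_bounds ℝ (ρ := -a) (ε := 1 / 10) ha0.le
    (by linarith) (by norm_num))
  have ev2 := hodd1.eventually ((tendsto_pow_atTop_atTop_of_one_lt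
    ((one_lt_inv₀ ha0).2 (by linarith : -a < 1))).eventually_ge_atTop 3)
  have ev3 := hodd1.eventually ((tendsto_pow_atTop_nhds_zero_of_lt_one (r := -b / -a)
    (by positivity) (by rw [div_lt_one ha0]; linarith)).eventually_le_const
      (show (0 : ℝ) < 1 / 10 by norm_num))
  have ev4 := hodd1.eventually ((tendsto_pow_atTop_nhds_zero_of_lt_one (r := -b)
    hb0.le (by linarith)).eventually_le_const (show (0 : ℝ) < 1 / 10 by norm_num))
  obtain ⟨p, h1, h2, h3, h4⟩ := (ev1.and (ev2.and (ev3.and ev4))).exists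
  set n := 2 * p + 1 with hn
  have hnodd : Odd n := ⟨p, rfl⟩
  set m := ⌈(-a)⁻¹ ^ n⌉₊ with hm
  have hm_ge : (-a)⁻¹ ^ n ≤ m := Nat.le_ceil _
  have hm_lt : (m : ℝ) < (-a)⁻¹ ^ n + 1 := Nat.ceil_lt_add_one (by positivity)
  have hm3 : 3 ≤ m := by
    have : (3 : ℝ) ≤ m := h2.trans hm_ge
    exact_mod_cast this
  let g : ℝ → ℝ := fun x => cliqueRel x (2 * p + 2) + m * (x ^ n * cliqueSplit x (2 * p))
  have hg : Continuous g :=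
    (differentiable_cliqueRel ℝ _).continuous.add (continuous_const.mul
      ((continuous_pow n).mul (differentiable_cliqueSplit ℝ _).continuous))
  have hneg : ∀ x : ℝ, x ^ n = -((-x) ^ n) := fun x => by rw [hnodd.neg_pow, neg_neg]
  have hga : g a ≤ 0 := by
    obtain ⟨b1, b2⟩ := h1 a (by rw [Real.norm_eq_abs, abs_of_neg (by linarith)])
    rw [Real.norm_eq_abs, abs_le] at b1 b2
    have c : 1 ≤ m * (-a) ^ n := by
      calc (1 : ℝ) = (-a)⁻¹ ^ n * (-a) ^ n := by
            rw [← mul_pow, inv_mul_cancel₀ ha0.ne', one_pow]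
        _ ≤ _ := by gcongr
    have e : g a = cliqueRel a (2 * p + 2) - (m * (-a) ^ n) * cliqueSplit a (2 * p) := by
      simp only [g]
      rw [hneg]
      ring
    rw [e]
    nlinarith
  have hgb : 0 ≤ g b := by
    obtain ⟨b1, b2⟩ := h1 b (by rw [Real.norm_eq_abs, abs_of_neg (by linarith)]; linarith)
    rw [Real.norm_eq_abs, abs_le] at b1 b2
    have c : m * (-b) ^ n ≤ 1 / 5 := by
      calc m * (-b) ^ n ≤ ((-a)⁻¹ ^ n + 1) * (-b) ^ n := by gcongr
        _ = (-b / -a) ^ n + (-b) ^ n := by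
            rw [add_mul, one_mul, ← mul_pow, div_eq_mul_inv, mul_comm (-b)]
        _ ≤ _ := by linarith
    have c0 : 0 ≤ m * (-b) ^ n := by positivity
    have e : g b = cliqueRel b (2 * p + 2) - (m * (-b) ^ n) * cliqueSplit b (2 * p) := by
      simp only [g]
      rw [hneg]
      ring
    rw [e]
    nlinarith
  obtain ⟨x, hx, hgx⟩ := intermediate_value_Icc hab.le hg.continuousOn ⟨hga, hgb⟩
  refine ⟨x, hx, mem_cycleOfCliquesRoots (m := m) (M := 2 * p) hm3 ?_⟩
  rw [ofReal_cliqueRel, ofReal_cliqueSplit]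
  exact_mod_cast hgx

theorem Icc_subset_closure_real_cycleOfCliquesRoots :
    Set.Icc (-1 : ℝ) 0 ⊆
      closure {x : ℝ | x ∈ Set.Icc (-1 : ℝ) 0 ∧ (x : ℂ) ∈ cycleOfCliquesRoots} := by
  rw [← closure_Ioo (by norm_num : (-1 : ℝ) ≠ 0)]
  refine closure_minimal ?_ isClosed_closure
  rintro x ⟨h1, h2⟩
  rw [Metric.mem_closure_iff]
  intro ε hε
  obtain ⟨b, hb1, hb2⟩ := exists_between (lt_min h2 (lt_add_of_pos_right x hε))
  obtain ⟨y, hy, hroot⟩ := exists_real_cycleOfCliquesRoot_mem_Icc h1 hb1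
    (hb2.trans_le (min_le_left _ _))
  have hb3 := hb2.trans_le (min_le_left _ _)
  have hb4 := hb2.trans_le (min_le_right _ _)
  rw [closure_Ioo (by norm_num : (-1 : ℝ) ≠ 0)]
  refine ⟨y, ⟨⟨by linarith [hy.1], by linarith [hy.2]⟩, hroot⟩, ?_⟩
  rw [Real.dist_eq, abs_lt]
  constructor <;> linarith [hy.1, hy.2]

theorem cycleOfCliquesRoots_subset : cycleOfCliquesRoots ⊆ simpleReliabilityRoots := by
  rintro q ⟨m, n, hm, hn, h⟩
  exact ⟨_, _, _, cycleOfCliques_connected m n hm hn, h⟩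

lemma one_mem_simpleReliabilityRoots : (1 : ℂ) ∈ simpleReliabilityRoots := by
  refine cycleOfCliquesRoots_subset ⟨3, 1, le_rfl, le_rfl, ?_⟩
  have h := reliability_cycleOfCliques 2 0 le_rfl (1 : ℂ)
  have h2 : cliqueRel (1 : ℂ) (0 + 2) = 0 := by
    rw [cliqueRel_succ]
    simp [cliqueRel_one]
  rw [h2] at h
  simpa using h

end Density

theorem theorem1 :
    -- reliability roots of simple graphs are dense in the closed unit disk
    Metric.closedBall (0 : ℂ) 1 ⊆ closure simpleReliabilityRoots ∧
    -- the real reliability roots are dense in `[-1, 0]`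
    Set.Icc (-1 : ℝ) 0 ⊆
      closure {x : ℝ | x ∈ Set.Icc (-1 : ℝ) 0 ∧ (x : ℂ) ∈ simpleReliabilityRoots} ∧
    -- the closure of the set of real reliability roots
    closure (simpleReliabilityRoots ∩ Set.range ((↑) : ℝ → ℂ)) =
      ((↑) : ℝ → ℂ) '' (Set.Icc (-1 : ℝ) 0 ∪ {1}) ∧
    -- both densities are witnessed by the connected graphs `C_m[K_{n+1}]`
    (∀ m n : ℕ, 3 ≤ m → 1 ≤ n → (cycleOfCliques m n).Connected) ∧
    Metric.closedBall (0 : ℂ) 1 ⊆ closure cycleOfCliquesRoots ∧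
    Set.Icc (-1 : ℝ) 0 ⊆
      closure {x : ℝ | x ∈ Set.Icc (-1 : ℝ) 0 ∧ (x : ℂ) ∈ cycleOfCliquesRoots} := by
  have hreal : Set.Icc (-1 : ℝ) 0 ⊆
      closure {x : ℝ | x ∈ Set.Icc (-1 : ℝ) 0 ∧ (x : ℂ) ∈ simpleReliabilityRoots} :=
    Icc_subset_closure_real_cycleOfCliquesRoots.trans
      (closure_mono fun x hx => ⟨hx.1, cycleOfCliquesRoots_subset hx.2⟩)
  refine ⟨closedBall_subset_closure_cycleOfCliquesRoots.trans
    (closure_mono cycleOfCliquesRoots_subset), hreal, ?_, cycleOfCliques_connected,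
    closedBall_subset_closure_cycleOfCliquesRoots, Icc_subset_closure_real_cycleOfCliquesRoots⟩
  apply Set.Subset.antisymm
  · refine closure_minimal ?_
      ((isCompact_Icc.union isCompact_singleton).image Complex.continuous_ofReal).isClosed
    rintro _ ⟨hz, x, rfl⟩
    exact ⟨x, mem_of_ofReal_mem_simpleReliabilityRoots hz, rfl⟩
  · rw [Set.image_union, Set.image_singleton]
    refine Set.union_subset ?_ ?_
    · refine (Set.image_mono hreal).trans ((image_closure_subset_closure_image
        Complex.continuous_ofReal).trans (closure_mono ?_))
      rintro _ ⟨x, hx, rfl⟩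
      exact ⟨hx.2, x, rfl⟩
    · rw [Set.singleton_subset_iff]
      exact subset_closure ⟨by simpa using one_mem_simpleReliabilityRoots, 1, rfl⟩
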